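/- Let $\{\varphi_n\}$ ($n\in\mathbb N$ or $n\in\mathbb Z$) be an orthonormal system in the complex space $L_2=L_2(0,1)$ with $M:=\sup_n\|\varphi_n\|_{L_\infty}<\infty$, and let $\mathcal F^{-1}$ be the map $\{c_n\}\mapsto\sum_n c_n\varphi_n$, the series converging in $L_2$. Write $f^*$ for the non-increasing rearrangement of $|f|$ on $[0,1]$ and $c_1^*\ge c_2^*\ge\dots$ for the non-increasing rearrangement of $\{|c_n|\}$. For $0<q\le\infty$ and $\alpha\in\mathbb R$ (with $1/\infty=0$) put $$\|c\|_{l_{2,q}(\log l)_\alpha}=\big\|k^{\frac12-\frac1q}(1+\log k)^\alpha c_k^*\big\|_{l_q(\mathbb{N})},\qquad \|f\|_{L_{2,q}(\log L)_\alpha}=\big\|t^{\frac12-\frac1q}(1+|\log t|)^\alpha f^*(t)\big\|_{L_q(0,1)},$$ $$\|f\|_{L^{\mathcal L}_{2,q,\alpha,2}}=\Big\|t^{-\frac1q}(1+|\log t|)^\alpha\Big(\int_0^t f^*(u)^2\,du\Big)^{1/2}\Big\|_{L_q(0,1)},$$ let each space consist of the elements with finite (quasi-)norm, and give an intersection of two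 spaces the maximum of the two (quasi-)norms. **Corollary 4.4.** Let $1<q\le\infty$ and $\max(-1/q,\,1/q-1)<\alpha<1-1/q$. Then for every sufficiently small $\varepsilon>0$ (depending only on $q,\alpha$) there is a constant $C$ depending only on $q,\alpha,\varepsilon$ such that, for every such system, the series $\sum_n c_n\varphi_n$ converges in $L_2$ for each $c\in l_{2,q}(\log l)_{\alpha+1/\min(q,2)}$, and $$\big\|\mathcal F^{-1}\,\big|\,l_{2,q}(\log l)_{\alpha+1/\min(q,2)}\to L^{\mathcal L}_{2,q,\alpha,2}\big\|\le C\,(1+\log M)^{|\alpha+\varepsilon+1/q|},$$ $$\big\|\mathcal F^{-1}\,\big|\,l_{2,q}(\log l)_{\alpha+1/\min(q,2)}\to L_{2,q}(\log L)_{\alpha+1/\max(q,2)}\cap L_{2,\max(q,2)}(\log L)_{\alpha+1/q}\big\|\le C\,(1+\log M)^{|\alpha+\varepsilon+1/q|}.$$ -/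

import Mathlib

open MeasureTheory Set
open scoped ENNReal NNReal

noncomputable section

namespace LorentzZygmund

/-- The real number `1 / q` for `0 < q ≤ ∞`, with `1 / ∞ = 0`. -/
def recip (q : ℝ≥0∞) : ℝ := (q⁻¹).toReal

/-- Lebesgue measure on `[0, 1]`. -/
def μ01 : Measure ℝ := volume.restrict (Icc 0 1)

/-- The non-increasing rearrangement
`f^*(t) = inf {s ≥ 0 : |{x ∈ [0,1] : |f x| > s}| ≤ t}` of a function `f` on `[0, 1]`. -/
def rearr (f : ℝ → ℂ) (t : ℝ) : ℝ≥0∞ :=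
  sInf {s : ℝ≥0∞ | μ01 {x | s < ‖f x‖ₑ} ≤ ENNReal.ofReal t}

/-- The non-increasing rearrangement of a family of complex numbers:
`seqRearr c j` is `c^*_{j+1} = inf {s ≥ 0 : #{n : |c n| > s} ≤ j}`, so that `seqRearr c 0` is the
supremum of the numbers `|c n|`. -/
def seqRearr {ι : Type} (c : ι → ℂ) (j : ℕ) : ℝ≥0∞ :=
  sInf {s : ℝ≥0∞ | {n | s < ‖c n‖ₑ}.encard ≤ (j : ℕ∞)}

/-- The (quasi-)norm of the Lorentz–Zygmund function space `L_{p,q}(log L)_α`: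
`‖ t^{1/p-1/q} (1+|log t|)^α f^*(t) | L_q(0,1) ‖`. The space is the set where it is finite. -/
def lzNorm (p q : ℝ≥0∞) (α : ℝ) (f : ℝ → ℂ) : ℝ≥0∞ :=
  eLpNorm (fun t : ℝ =>
      ENNReal.ofReal (t ^ (recip p - recip q) * (1 + |Real.log t|) ^ α) * rearr f t)
    q (volume.restrict (Ioo 0 1))

/-- The (quasi-)norm of the Lorentz–Zygmund sequence space `l_{p,q}(log l)_α`:
`‖ k^{1/p-1/q} (1+log k)^α c^*_k | l_q ‖`, where `k = j + 1` runs over the positive integers.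
The space is the set where it is finite. -/
def lzSeqNorm {ι : Type} (p q : ℝ≥0∞) (α : ℝ) (c : ι → ℂ) : ℝ≥0∞ :=
  eLpNorm (fun j : ℕ =>
      ENNReal.ofReal (((j : ℝ) + 1) ^ (recip p - recip q) * (1 + Real.log ((j : ℝ) + 1)) ^ α)
        * seqRearr c j)
    q Measure.count

/-- The (quasi-)norm of the limiting space `L^𝓛_{p,q,α,r}`:
`‖ t^{-1/q} (1+|log t|)^α ‖ u^{1/p-1/r} f^*(u) | L_r(0,t) ‖ | L_q(0,1) ‖`.
The space is the set where it is finite. -/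
def limNorm (p q : ℝ≥0∞) (α : ℝ) (r : ℝ≥0∞) (f : ℝ → ℂ) : ℝ≥0∞ :=
  eLpNorm (fun t : ℝ =>
      ENNReal.ofReal (t ^ (-recip q) * (1 + |Real.log t|) ^ α) *
        eLpNorm (fun u : ℝ => ENNReal.ofReal (u ^ (recip p - recip r)) * rearr f u)
          r (volume.restrict (Ioo 0 t)))
    q (volume.restrict (Ioo 0 1))

end LorentzZygmund

end

noncomputable section

namespace LorentzZygmund

/-! Put γ = α + 1/q > 0. For every K the series splits into the at most 2K terms whose coefficients
exceed c*_{2K+1}, and a remainder. By Cauchy–Schwarz the first part is bounded by M (2K)^{1/2} (∑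
(c_k^*)²)^{1/2}; by Parseval the remainder has L_2-norm at most (2 ∑_{k>K} (c_k^*)²)^{1/2}. This
bounds (∫_0^t f*²)^{1/2} for all t and K (`exists_hasSum_partialL2_le`), and it is the only place
where orthonormality and the uniform bound act together.

Both sides are then cut into blocks on which the logarithmic weight is about 2^n. With t = exp(1 -
2^{n+2}) and K about exp(2^n - 1), the factor t^{1/2} beats M K^{1/2} once 2^n ≥ 1 + log M, so f at
level n + 2 is controlled by the coefficient tail at level n plus a multiple of exp(-2^n/2). The
lower levels get the crude bound without t; their weights 2^{mγ} sum to a multiple of (1 + log M)^γ,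
which is where M enters the final constant (`exists_blockNorm_le`).

A geometric Hardy inequality (`exists_eLpNorm_tail_le`) replaces tails by single blocks. What
remains is to compare exponents q and 2 inside one block: in one direction Hölder costs a power of
the block measure, about 2^n, which alters the logarithmic exponent; in the other, monotonicity of
the rearrangement gives the comparison at no cost. This produces min(q,2) on the coefficient side
and max(q,2) on the function side. -/

/-! ### `L_p`-norms: distribution functions, fibres, change of exponent. -/

/-- The layer-cake formula for `ℝ≥0∞`-valued functions. -/
theorem lintegral_eq_lintegral_measure_lt {X : Type*} [MeasurableSpace X] {μ : Measure X}
    [SFinite μ] {f : X → ℝ≥0∞} (hf : Measurable f) :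
    ∫⁻ x, f x ∂μ = ∫⁻ s in Ioi (0 : ℝ), μ {x | ENNReal.ofReal s < f x} := by
  have h1 : ∀ a : ℝ≥0∞, a = ∫⁻ s in Ioi (0 : ℝ), {s : ℝ | ENNReal.ofReal s < a}.indicator 1 s := by
    intro a
    have hms : MeasurableSet {s : ℝ | ENNReal.ofReal s < a} :=
      measurableSet_lt ENNReal.measurable_ofReal measurable_const
    rw [lintegral_indicator_one hms, Measure.restrict_apply hms]
    rcases eq_or_ne a ∞ with rfl | ha
    · simp [ENNReal.ofReal_lt_top]
    · have : {s : ℝ | ENNReal.ofReal s < a} ∩ Ioi 0 = Ioo 0 a.toReal := by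
        ext s
        simp only [mem_inter_iff, mem_ofPred_eq, mem_Ioi, mem_Ioo]
        constructor
        · rintro ⟨h, hs⟩
          exact ⟨hs, (ENNReal.ofReal_lt_iff_lt_toReal hs.le ha).1 h⟩
        · rintro ⟨hs, h⟩
          exact ⟨(ENNReal.ofReal_lt_iff_lt_toReal hs.le ha).2 h, hs⟩
      rw [this, Real.volume_Ioo, sub_zero, ENNReal.ofReal_toReal ha]
  have hm : MeasurableSet {z : X × ℝ | ENNReal.ofReal z.2 < f z.1} :=
    measurableSet_lt (ENNReal.measurable_ofReal.comp measurable_snd) (hf.comp measurable_fst)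
  calc ∫⁻ x, f x ∂μ
      = ∫⁻ x, (∫⁻ s in Ioi (0 : ℝ),
          {z : X × ℝ | ENNReal.ofReal z.2 < f z.1}.indicator 1 (x, s)) ∂μ :=
        lintegral_congr fun x => h1 (f x)
    _ = ∫⁻ s in Ioi (0 : ℝ), ∫⁻ x,
          {z : X × ℝ | ENNReal.ofReal z.2 < f z.1}.indicator 1 (x, s) ∂μ := by
        refine lintegral_lintegral_swap ?_
        exact (measurable_one.indicator hm).aemeasurable
    _ = _ := by
        refine lintegral_congr fun s => ?_
        have : MeasurableSet {x | ENNReal.ofReal s < f x} := measurableSet_lt measurable_const hf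
        rw [← lintegral_indicator_one this]
        rfl

/-- Domination of distribution functions implies domination of `L_p`-norms. -/
theorem eLpNorm_le_of_measure_lt_le {X Y : Type*} [MeasurableSpace X] [MeasurableSpace Y]
    {μ : Measure X} {ν : Measure Y} [SFinite μ] [SFinite ν] {f : X → ℝ≥0∞} {g : Y → ℝ≥0∞}
    (hf : Measurable f) (hg : Measurable g) {p : ℝ≥0∞} (hp0 : p ≠ 0) (hp : p ≠ ∞)
    (h : ∀ s, μ {x | s < f x} ≤ ν {y | s < g y}) : eLpNorm f p μ ≤ eLpNorm g p ν := by
  have hp' : 0 < p.toReal := ENNReal.toReal_pos hp0 hp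
  rw [eLpNorm_eq_lintegral_rpow_enorm_toReal hp0 hp, eLpNorm_eq_lintegral_rpow_enorm_toReal hp0 hp]
  refine ENNReal.rpow_le_rpow ?_ (by positivity)
  simp only [enorm_eq_self]
  rw [lintegral_eq_lintegral_measure_lt (hf.pow_const _),
    lintegral_eq_lintegral_measure_lt (hg.pow_const _)]
  refine lintegral_mono fun s => ?_
  have := h (ENNReal.ofReal s ^ (1 / p.toReal))
  simpa only [one_div, ENNReal.rpow_inv_lt_iff hp'] using this

theorem eLpNorm_sum_measure {X : Type*} [MeasurableSpace X] (μ : ℕ → Measure X) (f : X → ℝ≥0∞)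
    {p : ℝ≥0∞} (hp0 : p ≠ 0) :
    eLpNorm f p (Measure.sum μ) = eLpNorm (fun m => eLpNorm f p (μ m)) p Measure.count := by
  rcases eq_or_ne p ∞ with rfl | hp
  · simp only [eLpNorm_exponent_top, eLpNormEssSup_count, enorm_eq_self]
    apply le_antisymm
    · refine essSup_le_of_ae_le _ ?_
      rw [Filter.EventuallyLE, Measure.ae_sum_iff]
      intro m
      filter_upwards [ae_le_eLpNormEssSup (f := f) (μ := μ m)] with x hx
      exact hx.trans (le_iSup (fun m => eLpNormEssSup f (μ m)) m)
    · exact iSup_le fun m => eLpNormEssSup_mono_measure f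
        (Measure.absolutelyContinuous_of_le (Measure.le_sum μ m))
  · have hp' : 0 < p.toReal := ENNReal.toReal_pos hp0 hp
    simp only [eLpNorm_eq_lintegral_rpow_enorm_toReal hp0 hp, enorm_eq_self,
      lintegral_sum_measure, lintegral_count]
    congr 1
    refine tsum_congr fun m => ?_
    rw [← ENNReal.rpow_mul, one_div_mul_cancel hp'.ne', ENNReal.rpow_one]

/-- An `L_p`-norm is the `l_p`-norm of the `L_p`-norms over the fibres of a level function. -/
theorem eLpNorm_eq_eLpNorm_fiber {X : Type*} [MeasurableSpace X] (μ : Measure X) (f : X → ℝ≥0∞)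
    {p : ℝ≥0∞} (hp0 : p ≠ 0) {L : X → ℕ} (hL : Measurable L) :
    eLpNorm f p μ =
      eLpNorm (fun m => eLpNorm f p (μ.restrict (L ⁻¹' {m}))) p Measure.count := by
  rw [← eLpNorm_sum_measure _ _ hp0, ← Measure.restrict_iUnion
    (fun i j hij => Disjoint.preimage _ (by simpa using hij))
    (fun m => hL (measurableSet_singleton m))]
  rw [← preimage_iUnion, iUnion_of_singleton, preimage_univ, Measure.restrict_univ]

/-- Minkowski's inequality for finite sums passes to the limit by monotone convergence, or by
countably many a.e. bounds when `p = ∞`. -/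
theorem eLpNorm_tsum_le {X : Type*} [MeasurableSpace X] {μ : Measure X} {f : ℕ → X → ℝ≥0∞}
    (hf : ∀ i, Measurable (f i)) {p : ℝ≥0∞} (hp1 : 1 ≤ p) :
    eLpNorm (fun x => ∑' i, f i x) p μ ≤ ∑' i, eLpNorm (f i) p μ := by
  have key : ∀ N, eLpNorm (fun x => ∑ i ∈ Finset.range N, f i x) p μ ≤ ∑' i, eLpNorm (f i) p μ := by
    intro N
    have h := eLpNorm_sum_le (μ := μ) (p := p) (s := Finset.range N) (f := f)
      (fun i _ => (hf i).aestronglyMeasurable) hp1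
    have e : (∑ i ∈ Finset.range N, f i) = fun x => ∑ i ∈ Finset.range N, f i x := by
      ext x; simp
    rw [e] at h
    exact h.trans (ENNReal.sum_le_tsum _)
  have hp0 : p ≠ 0 := (zero_lt_one.trans_le hp1).ne'
  rcases eq_or_ne p ∞ with rfl | hp
  · refine essSup_le_of_ae_le _ ?_
    have : ∀ᵐ x ∂μ, ∀ N, ∑ i ∈ Finset.range N, f i x ≤ ∑' i, eLpNorm (f i) ∞ μ := by
      refine ae_all_iff.2 fun N => ?_
      filter_upwards [ae_le_eLpNormEssSup (f := fun x => ∑ i ∈ Finset.range N, f i x) (μ := μ)]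
        with x hx
      exact hx.trans (by simpa [eLpNorm_exponent_top] using key N)
    filter_upwards [this] with x hx
    simp only [enorm_eq_self]
    rw [ENNReal.tsum_eq_iSup_nat]
    exact iSup_le hx
  · have hp' : 0 < p.toReal := ENNReal.toReal_pos hp0 hp
    simp only [eLpNorm_eq_lintegral_rpow_enorm_toReal hp0 hp, enorm_eq_self, one_div,
      ENNReal.rpow_inv_le_iff hp'] at key ⊢
    have e : ∀ x, (∑' i, f i x) ^ p.toReal = ⨆ N, (∑ i ∈ Finset.range N, f i x) ^ p.toReal := by
      intro x
      rw [ENNReal.tsum_eq_iSup_nat]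
      exact (ENNReal.orderIsoRpow p.toReal hp').map_iSup _
    simp only [e]
    rw [lintegral_iSup]
    · exact iSup_le key
    · intro N
      exact (Finset.measurable_sum _ fun i _ => hf i).pow_const _
    · intro a b hab x
      exact ENNReal.rpow_le_rpow
        (Finset.sum_le_sum_of_subset (Finset.range_mono hab)) hp'.le

/-- If a function and its `L_p`-norm are both at most `A`, so is its `L_r`-norm for `p ≤ r`. -/
theorem eLpNorm_le_of_exponent_le_of_bound {X : Type*} [MeasurableSpace X] {μ : Measure X}
    {g : X → ℝ≥0∞} {p r A : ℝ≥0∞} (hp0 : p ≠ 0) (hpr : p ≤ r)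
    (hA : ∀ᵐ x ∂μ, g x ≤ A) (h : eLpNorm g p μ ≤ A) : eLpNorm g r μ ≤ A := by
  rcases eq_or_ne r ∞ with rfl | hr
  · exact essSup_le_of_ae_le _ hA
  have hp : p ≠ ∞ := ne_top_of_le_ne_top hr hpr
  have hr0 : r ≠ 0 := fun h0 => hp0 (by simpa [h0] using hpr)
  have hp' : 0 < p.toReal := ENNReal.toReal_pos hp0 hp
  have hr' : 0 < r.toReal := ENNReal.toReal_pos hr0 hr
  have hpr' : 0 ≤ r.toReal - p.toReal := sub_nonneg.2 (ENNReal.toReal_mono hr hpr)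
  simp only [eLpNorm_eq_lintegral_rpow_enorm_toReal hp0 hp,
    eLpNorm_eq_lintegral_rpow_enorm_toReal hr0 hr, enorm_eq_self, one_div,
    ENNReal.rpow_inv_le_iff hp', ENNReal.rpow_inv_le_iff hr'] at h ⊢
  rcases eq_or_ne A ∞ with rfl | hAt
  · simp [hr']
  calc ∫⁻ x, g x ^ r.toReal ∂μ ≤ ∫⁻ x, A ^ (r.toReal - p.toReal) * g x ^ p.toReal ∂μ := by
        refine lintegral_mono_ae ?_
        filter_upwards [hA] with x hx
        calc g x ^ r.toReal = g x ^ ((r.toReal - p.toReal) + p.toReal) := by ring_nf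
          _ = g x ^ (r.toReal - p.toReal) * g x ^ p.toReal :=
              ENNReal.rpow_add_of_nonneg _ _ hpr' hp'.le
          _ ≤ _ := by gcongr
    _ = A ^ (r.toReal - p.toReal) * ∫⁻ x, g x ^ p.toReal ∂μ :=
        lintegral_const_mul' _ _ (ENNReal.rpow_ne_top_of_nonneg hpr' hAt)
    _ ≤ A ^ (r.toReal - p.toReal) * A ^ p.toReal := by gcongr
    _ = A ^ r.toReal := by
        rw [← ENNReal.rpow_add_of_nonneg _ _ hpr' hp'.le]
        ring_nf

theorem le_eLpNorm_count (y : ℕ → ℝ≥0∞) {p : ℝ≥0∞} (hp0 : p ≠ 0) (n : ℕ) :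
    y n ≤ eLpNorm y p Measure.count := by
  rcases eq_or_ne p ∞ with rfl | hp
  · simpa [eLpNorm_exponent_top] using le_iSup y n
  · have hp' : 0 < p.toReal := ENNReal.toReal_pos hp0 hp
    simp only [eLpNorm_eq_lintegral_rpow_enorm_toReal hp0 hp, enorm_eq_self, one_div,
      ENNReal.le_rpow_inv_iff hp', lintegral_count]
    exact ENNReal.le_tsum n

theorem eLpNorm_count_anti (y : ℕ → ℝ≥0∞) {p r : ℝ≥0∞} (hp0 : p ≠ 0) (hpr : p ≤ r) :
    eLpNorm y r Measure.count ≤ eLpNorm y p Measure.count :=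
  eLpNorm_le_of_exponent_le_of_bound hp0 hpr
    (Filter.Eventually.of_forall (le_eLpNorm_count y hp0)) le_rfl

/-- The weight `w^{1/p}` is absorbed into the measure. -/
theorem eLpNorm_rpow_recip_mul {X : Type*} [MeasurableSpace X] {μ : Measure X}
    {w g : X → ℝ≥0∞} (hw : Measurable w) (hw0 : ∀ᵐ x ∂μ, w x ≠ 0) (hwt : ∀ᵐ x ∂μ, w x < ∞)
    {p : ℝ≥0∞} (hp0 : p ≠ 0) :
    eLpNorm (fun x => w x ^ recip p * g x) p μ = eLpNorm g p (μ.withDensity w) := by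
  rcases eq_or_ne p ∞ with rfl | hp
  · simp only [recip, ENNReal.inv_top, ENNReal.toReal_zero, ENNReal.rpow_zero, one_mul,
      eLpNorm_exponent_top]
    exact le_antisymm
      (eLpNormEssSup_mono_measure _ (withDensity_absolutelyContinuous' hw.aemeasurable hw0))
      (eLpNormEssSup_mono_measure _ (withDensity_absolutelyContinuous _ _))
  · have hp' : 0 < p.toReal := ENNReal.toReal_pos hp0 hp
    simp only [eLpNorm_eq_lintegral_rpow_enorm_toReal hp0 hp, enorm_eq_self]
    rw [lintegral_withDensity_eq_lintegral_mul_non_measurable₀ _ hw.aemeasurable hwt]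
    congr 1
    refine lintegral_congr fun x => ?_
    rw [Pi.mul_apply, ENNReal.mul_rpow_of_nonneg _ _ hp'.le, ← ENNReal.rpow_mul, recip,
      ENNReal.toReal_inv, inv_mul_cancel₀ hp'.ne', ENNReal.rpow_one]

theorem tsum_sq_le_of_encard_lt_le {ι κ : Type*} [Countable ι] [Countable κ] (f : ι → ℝ≥0∞)
    (g : κ → ℝ≥0∞) (h : ∀ s, {x | s < f x}.encard ≤ {y | s < g y}.encard) :
    ∑' x, f x ^ 2 ≤ ∑' y, g y ^ 2 := by
  let _ : MeasurableSpace ι := ⊤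
  let _ : MeasurableSpace κ := ⊤
  have := eLpNorm_le_of_measure_lt_le (μ := (Measure.count : Measure ι))
    (ν := (Measure.count : Measure κ)) (f := f) (g := g) measurable_from_top measurable_from_top
    (p := 2) (by simp) (by simp) (fun s => by
      rw [Measure.count_apply MeasurableSpace.measurableSet_top,
        Measure.count_apply MeasurableSpace.measurableSet_top]
      exact_mod_cast h s)
  rw [eLpNorm_eq_lintegral_rpow_enorm_toReal (by simp) (by simp),
    eLpNorm_eq_lintegral_rpow_enorm_toReal (by simp) (by simp)] at this
  simp only [enorm_eq_self, ENNReal.toReal_ofNat, lintegral_count, ENNReal.rpow_ofNat] at this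
  exact (ENNReal.rpow_le_rpow_iff (by norm_num)).1 this

/-! ### Rearrangement of the coefficients. -/

section Sequences

variable {ι : Type} (c : ι → ℂ)

theorem seqRearr_antitone : Antitone (seqRearr c) := by
  intro i j hij
  refine sInf_le_sInf fun s hs => ?_
  rw [mem_ofPred_eq] at hs ⊢
  exact hs.trans (by exact_mod_cast hij)

/-- If more than `k` indices exceed `s`, the smallest modulus among `k + 1` of them is still above
`s` and is a lower bound for the set whose infimum is taken. Equimeasurability of `c` and its
rearrangement follows. -/
theorem lt_seqRearr_iff (s : ℝ≥0∞) (k : ℕ) :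
    s < seqRearr c k ↔ (k : ℕ∞) < {n | s < ‖c n‖ₑ}.encard := by
  constructor
  · intro h
    by_contra! hk
    exact h.not_ge (sInf_le (mem_ofPred_eq.symm ▸ hk))
  · intro h
    have h1 : ((k + 1 : ℕ) : ℕ∞) ≤ {n | s < ‖c n‖ₑ}.encard := by
      push_cast
      exact Order.add_one_le_of_lt h
    obtain ⟨F, hF, hFc⟩ := exists_subset_encard_eq h1
    have hfin : F.Finite := finite_of_encard_eq_coe hFc
    have hne : F.Nonempty := by
      rw [← encard_pos, hFc]
      exact_mod_cast Nat.succ_pos k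
    obtain ⟨a, haF, ha⟩ := hfin.exists_minimalFor (fun n => ‖c n‖ₑ) F hne
    have hmin : ∀ n ∈ F, ‖c a‖ₑ ≤ ‖c n‖ₑ := fun n hn => by
      rcases le_total ‖c a‖ₑ ‖c n‖ₑ with h' | h'
      · exact h'
      · exact ha hn h'
    refine lt_of_lt_of_le (hF haF) (le_sInf fun s' hs' => ?_)
    by_contra! hlt
    have : F ⊆ {n | s' < ‖c n‖ₑ} := fun n hn => hlt.trans_le (hmin n hn)
    rw [mem_ofPred_eq] at hs'
    have h2 := (encard_le_encard this).trans hs'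
    rw [hFc] at h2
    have : k + 1 ≤ k := by exact_mod_cast h2
    omega

theorem encard_lt_seqRearr (s : ℝ≥0∞) :
    {k : ℕ | s < seqRearr c k}.encard = {n | s < ‖c n‖ₑ}.encard := by
  simp only [lt_seqRearr_iff]
  generalize {n | s < ‖c n‖ₑ}.encard = a
  induction a using ENat.recTopCoe with
  | top =>
    have : {k : ℕ | (k : ℕ∞) < ⊤} = univ := by ext k; simp
    rw [this]
    simp
  | coe n =>
    have : {k : ℕ | (k : ℕ∞) < n} = (Finset.range n : Set ℕ) := by ext k; simp
    rw [this, encard_coe_eq_coe_finsetCard, Finset.card_range]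

/-- The tail `∑_{k > K} (c_k^*)^2`. -/
def tailSq (K : ℕ) : ℝ≥0∞ := ∑' k, seqRearr c (k + K) ^ 2

/-- For `k < K` the cap satisfies `a (2 * K) ≤ a (k + K)`, so the first `K` capped terms are paid
for by the tail from `K`, and the other terms are that tail. This is why `2 * K` coefficients are
removed rather than `K`. -/
theorem tsum_sq_min_le {a : ℕ → ℝ≥0∞} (ha : Antitone a) (K : ℕ) :
    ∑' k, (min (a k) (a (2 * K))) ^ 2 ≤ 2 * ∑' k, a (k + K) ^ 2 := by
  have h : ∀ f : ℕ → ℝ≥0∞, ∑' k, f k = ∑ k ∈ Finset.range K, f k + ∑' k, f (k + K) :=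
    fun f => (Summable.sum_add_tsum_nat_add' ENNReal.summable).symm
  rw [h, two_mul (∑' k, a (k + K) ^ 2)]
  refine add_le_add ?_ (ENNReal.tsum_le_tsum fun k => ?_)
  · refine le_trans (Finset.sum_le_sum fun k hk => ?_) (ENNReal.sum_le_tsum (Finset.range K))
    gcongr
    refine (min_le_right _ _).trans (ha ?_)
    have := Finset.mem_range.1 hk
    omega
  · gcongr
    exact min_le_left _ _

theorem encard_truncate_le (τ s : ℝ≥0∞) :
    {n | s < if ‖c n‖ₑ ≤ τ then ‖c n‖ₑ else 0}.encard ≤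
      {k | s < min (seqRearr c k) τ}.encard := by
  rcases lt_or_ge s τ with hs | hs
  · have : {k | s < min (seqRearr c k) τ} = {k | s < seqRearr c k} := by
      ext k; simp [hs]
    rw [this, encard_lt_seqRearr]
    refine encard_le_encard fun n hn => ?_
    rw [mem_ofPred_eq] at hn ⊢
    split_ifs at hn with h
    · exact hn
    · simp at hn
  · have : {n | s < if ‖c n‖ₑ ≤ τ then ‖c n‖ₑ else 0} = ∅ := by
      ext n
      simp only [mem_ofPred_eq, mem_empty_iff_false, iff_false, not_lt]
      split_ifs with h
      · exact h.trans hs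
      · exact zero_le
    rw [this, encard_empty]
    exact zero_le

theorem tsum_sq_truncate_le [Countable ι] (K : ℕ) :
    ∑' n, (if ‖c n‖ₑ ≤ seqRearr c (2 * K) then ‖c n‖ₑ else 0) ^ 2 ≤ 2 * tailSq c K :=
  (tsum_sq_le_of_encard_lt_le _ _ fun s => encard_truncate_le c _ s).trans
    (tsum_sq_min_le (seqRearr_antitone c) K)

theorem tsum_sq_le_tailSq_zero [Countable ι] : ∑' n, ‖c n‖ₑ ^ 2 ≤ tailSq c 0 :=
  tsum_sq_le_of_encard_lt_le _ _ fun s => by simp only [add_zero, encard_lt_seqRearr, le_refl]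

end Sequences

/-! ### Rearrangement of functions on `[0, 1]`. -/

section Functions

theorem rearr_antitone (f : ℝ → ℂ) : Antitone (rearr f) := by
  intro a b hab
  exact sInf_le_sInf fun s hs => le_trans hs (ENNReal.ofReal_le_ofReal hab)

theorem rearr_le_add {f h : ℝ → ℂ} {A : ℝ≥0∞} (hfh : ∀ᵐ x ∂μ01, ‖f x‖ₑ ≤ A + ‖h x‖ₑ) (t : ℝ) :
    rearr f t ≤ A + rearr h t := by
  unfold rearr
  rw [ENNReal.add_sInf]
  refine le_iInf₂ fun s hs => sInf_le ?_
  refine le_trans (measure_mono_ae ?_) hs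
  filter_upwards [hfh] with x hx hx'
  exact lt_of_add_lt_add_left (lt_of_lt_of_le hx' hx)

theorem eLpNorm_rearr_le {h : ℝ → ℂ} (hm : StronglyMeasurable h) (t : ℝ) :
    eLpNorm (rearr h) 2 (volume.restrict (Ioo 0 t)) ≤ eLpNorm h 2 μ01 := by
  have : SFinite μ01 := by unfold μ01; infer_instance
  have e : eLpNorm h 2 μ01 = eLpNorm (fun x => ‖h x‖ₑ) 2 μ01 := (eLpNorm_enorm _).symm
  rw [e]
  refine eLpNorm_le_of_measure_lt_le (rearr_antitone h).measurable hm.enorm (by simp) (by simp)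
    fun s => ?_
  have hms : MeasurableSet {x | s < rearr h x} :=
    measurableSet_lt measurable_const (rearr_antitone h).measurable
  rw [Measure.restrict_apply hms]
  set a := μ01 {x | s < ‖h x‖ₑ} with ha
  rcases eq_or_ne a ∞ with hat | hat
  · rw [hat]; exact le_top
  calc volume ({x | s < rearr h x} ∩ Ioo 0 t) ≤ volume (Ioo 0 a.toReal) := by
        -- The infimum defining the rearrangement gives `rearr h u ≤ s` for every `u ≥ a`, so the
        -- superlevel set lies in `(0, a)`.
        refine measure_mono ?_
        rintro u ⟨hu, hu0, -⟩
        refine ⟨hu0, ?_⟩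
        by_contra! hle
        rw [mem_ofPred_eq] at hu
        refine hu.not_ge (sInf_le ?_)
        rw [mem_ofPred_eq, ← ha, ← ENNReal.ofReal_toReal hat]
        exact ENNReal.ofReal_le_ofReal hle
    _ = a := by rw [Real.volume_Ioo, sub_zero, ENNReal.ofReal_toReal hat]

/-- `(∫_0^t f^*(u)^2 du)^{1/2}` -/
def partialL2 (f : ℝ → ℂ) (t : ℝ) : ℝ≥0∞ := eLpNorm (rearr f) 2 (volume.restrict (Ioo 0 t))

theorem partialL2_mono (f : ℝ → ℂ) : Monotone (partialL2 f) := fun _ _ hab =>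
  eLpNorm_mono_measure _ (Measure.restrict_mono (Ioo_subset_Ioo_right hab) le_rfl)

theorem partialL2_le {f h : ℝ → ℂ} (hm : StronglyMeasurable h) {A : ℝ≥0∞}
    (hfh : ∀ᵐ x ∂μ01, ‖f x‖ₑ ≤ A + ‖h x‖ₑ) (t : ℝ) :
    partialL2 f t ≤ A * ENNReal.ofReal t ^ (1 / 2 : ℝ) + eLpNorm h 2 μ01 := by
  calc partialL2 f t
      ≤ eLpNorm ((fun _ => A) + rearr h) 2 (volume.restrict (Ioo 0 t)) :=
        eLpNorm_mono_enorm fun x => by simpa using rearr_le_add hfh x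
    _ ≤ eLpNorm (fun _ => A) 2 (volume.restrict (Ioo 0 t)) +
          eLpNorm (rearr h) 2 (volume.restrict (Ioo 0 t)) :=
        eLpNorm_add_le aestronglyMeasurable_const
          (rearr_antitone h).measurable.aestronglyMeasurable (by simp)
    _ ≤ _ := by
        refine add_le_add ?_ (eLpNorm_rearr_le hm t)
        rw [eLpNorm_eq_lintegral_rpow_enorm_toReal (by simp) (by simp)]
        simp only [enorm_eq_self, lintegral_const, Measure.restrict_apply_univ, Real.volume_Ioo,
          sub_zero, ENNReal.toReal_ofNat]
        rw [ENNReal.mul_rpow_of_nonneg _ _ (by norm_num), ← ENNReal.rpow_mul]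
        norm_num

end Functions

/-! ### Splitting an orthonormal series. -/

/-- Parseval's identity for series with square-summable coefficients. -/
theorem exists_hasSum_orthonormal {ι E : Type*} [NormedAddCommGroup E] [InnerProductSpace ℂ E]
    [CompleteSpace E] {φ : ι → E} (hφ : Orthonormal ℂ φ) (c : ι → ℂ)
    (hc : ∑' n, ‖c n‖ₑ ^ 2 ≠ ∞) :
    ∃ f : E, HasSum (fun n => c n • φ n) f ∧ ‖f‖ₑ ^ 2 = ∑' n, ‖c n‖ₑ ^ 2 := by
  have hs : Summable fun n => ‖c n‖ ^ 2 := by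
    have h : Summable fun n => ‖c n‖₊ ^ 2 := by
      rw [← ENNReal.tsum_coe_ne_top_iff_summable]
      simpa [enorm_eq_nnnorm] using hc
    simpa using NNReal.summable_coe.2 h
  have hmem : Memℓp c 2 := memℓp_gen (by simpa using hs)
  let c' : lp (fun _ : ι => ℂ) 2 := ⟨c, hmem⟩
  have hV := hφ.orthogonalFamily
  refine ⟨hV.linearIsometry c', ?_, ?_⟩
  · simpa [c'] using hV.hasSum_linearIsometry c'
  · have h1 : ‖hV.linearIsometry c'‖ ^ 2 = ∑' n, ‖c n‖ ^ 2 := by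
      rw [LinearIsometry.norm_map]
      have := lp.norm_rpow_eq_tsum (p := 2) (by simp) c'
      simpa [c'] using this
    have h2 : ∑' n, ‖c n‖ₑ ^ 2 = ENNReal.ofReal (∑' n, ‖c n‖ ^ 2) := by
      rw [ENNReal.ofReal_tsum_of_nonneg (fun n => by positivity) hs]
      refine tsum_congr fun n => ?_
      rw [ENNReal.ofReal_pow (norm_nonneg _), ofReal_norm]
    rw [h2, ← h1, ENNReal.ofReal_pow (norm_nonneg _), ofReal_norm]

theorem sum_le_sqrt_card_mul {ι : Type*} (S : Finset ι) (a : ι → ℝ≥0∞) :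
    ∑ n ∈ S, a n ≤ (S.card : ℝ≥0∞) ^ (1 / 2 : ℝ) * (∑ n ∈ S, a n ^ 2) ^ (1 / 2 : ℝ) := by
  simpa using ENNReal.inner_le_Lp_mul_Lq S (fun _ => 1) a
    Real.HolderConjugate.two_two

/-- The basic estimate for the sum of an orthonormal series, obtained by splitting off the
`2 K` largest coefficients. -/
theorem exists_hasSum_partialL2_le {ι : Type} [Countable ι] {φ : ι → Lp ℂ 2 μ01} {M : ℝ≥0∞}
    (hφ : Orthonormal ℂ φ) (hM : (⨆ n, eLpNorm (φ n) ∞ μ01) = M) (c : ι → ℂ)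
    (hc : tailSq c 0 ≠ ∞) :
    ∃ f : Lp ℂ 2 μ01, HasSum (fun n => c n • φ n) f ∧ ∀ (t : ℝ) (K : ℕ),
      partialL2 f t ≤ M * (2 * K : ℝ≥0∞) ^ (1 / 2 : ℝ) * tailSq c 0 ^ (1 / 2 : ℝ) *
        ENNReal.ofReal t ^ (1 / 2 : ℝ) + (2 * tailSq c K) ^ (1 / 2 : ℝ) := by
  classical
  have hc2 : ∑' n, ‖c n‖ₑ ^ 2 ≠ ∞ := ne_top_of_le_ne_top hc (tsum_sq_le_tailSq_zero c)
  obtain ⟨f, hf, -⟩ := exists_hasSum_orthonormal hφ c hc2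
  refine ⟨f, hf, fun t K => ?_⟩
  -- With zero-based indexing this is c*_{2K+1}: at most `2 * K` coefficients lie strictly above it,
  -- and ties go to the remainder `d`.
  set τ := seqRearr c (2 * K) with hτ
  have hcard : {n | τ < ‖c n‖ₑ}.encard ≤ (2 * K : ℕ) := by
    by_contra! h
    exact lt_irrefl _ ((lt_seqRearr_iff c τ (2 * K)).2 h)
  have hfin : {n | τ < ‖c n‖ₑ}.Finite := finite_of_encard_le_coe hcard
  set S := hfin.toFinset with hS
  have hScard : S.card ≤ 2 * K := by
    have : ((S : Set ι)).encard ≤ (2 * K : ℕ) := by simpa [hS] using hcard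
    rw [encard_coe_eq_coe_finsetCard] at this
    exact_mod_cast this
  set b : ι → ℂ := fun n => if n ∈ S then c n else 0 with hb
  set d : ι → ℂ := fun n => if ‖c n‖ₑ ≤ τ then c n else 0 with hd
  have hd2 : ∑' n, ‖d n‖ₑ ^ 2 ≤ 2 * tailSq c K := by
    refine le_trans (le_of_eq (tsum_congr fun n => ?_)) (tsum_sq_truncate_le c K)
    simp only [hd, ← hτ]
    split_ifs <;> simp
  have hd3 : ∑' n, ‖d n‖ₑ ^ 2 ≠ ∞ := by
    refine ne_top_of_le_ne_top hc2 (ENNReal.tsum_le_tsum fun n => ?_)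
    simp only [hd]
    split_ifs <;> simp
  obtain ⟨h, hh, hhn⟩ := exists_hasSum_orthonormal hφ d hd3
  set g : Lp ℂ 2 μ01 := ∑ n ∈ S, c n • φ n with hg
  have hgs : HasSum (fun n => b n • φ n) g := by
    have := hasSum_sum_of_ne_finset_zero (f := fun n => b n • φ n) (s := S) (L := .unconditional ι)
      (fun n hn => by simp [hb, hn])
    convert this using 1
    exact Finset.sum_congr rfl fun n hn => by simp [hb, hn]
  have hfgh : f = g + h := by
    refine hf.unique ?_
    convert hgs.add hh using 1
    ext1 n
    rw [← add_smul]
    congr 1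
    by_cases hn : τ < ‖c n‖ₑ
    · simp [hb, hd, hS, hn]
    · simp [hb, hd, hS, hn, not_lt.1 hn]
  have hφM : ∀ n, ∀ᵐ x ∂μ01, ‖φ n x‖ₑ ≤ M := fun n => by
    filter_upwards [ae_le_eLpNormEssSup (f := φ n) (μ := μ01)] with x hx
    refine hx.trans ?_
    rw [← hM, ← eLpNorm_exponent_top]
    exact le_iSup (fun n => eLpNorm (φ n) ∞ μ01) n
  have hgA : ∀ᵐ x ∂μ01, ‖g x‖ₑ ≤ M * ∑ n ∈ S, ‖c n‖ₑ := by
    have h1 : ∀ᵐ x ∂μ01, g x = ∑ n ∈ S, c n * φ n x := by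
      have h2 : ∀ᵐ x ∂μ01, ∀ n ∈ S, (c n • φ n : Lp ℂ 2 μ01) x = c n * φ n x := by
        rw [Filter.eventually_all_finset]
        intro n _
        filter_upwards [Lp.coeFn_smul (c n) (φ n)] with x hx
        simpa using hx
      filter_upwards [Lp.coeFn_finsetSum S (fun n => c n • φ n), h2] with x hx hx2
      rw [hg, hx, Finset.sum_apply]
      exact Finset.sum_congr rfl fun n hn => hx2 n hn
    have h3 : ∀ᵐ x ∂μ01, ∀ n ∈ S, ‖φ n x‖ₑ ≤ M := by
      rw [Filter.eventually_all_finset]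
      exact fun n _ => hφM n
    filter_upwards [h1, h3] with x hx hx3
    rw [hx, Finset.mul_sum]
    refine (enorm_sum_le _ _).trans (Finset.sum_le_sum fun n hn => ?_)
    rw [enorm_mul, mul_comm]
    gcongr
    exact hx3 n hn
  have hfx : ∀ᵐ x ∂μ01, ‖f x‖ₑ ≤ M * ∑ n ∈ S, ‖c n‖ₑ + ‖h x‖ₑ := by
    filter_upwards [hgA, Lp.coeFn_add g h] with x hx hx2
    rw [hfgh, hx2]
    exact (enorm_add_le _ _).trans (by gcongr)
  refine (partialL2_le (Lp.stronglyMeasurable h) hfx t).trans (add_le_add ?_ ?_)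
  · suffices h : ∑ n ∈ S, ‖c n‖ₑ ≤ (2 * K : ℝ≥0∞) ^ (1 / 2 : ℝ) * tailSq c 0 ^ (1 / 2 : ℝ) by
      rw [mul_assoc M (_ ^ _)]
      gcongr
    refine (sum_le_sqrt_card_mul S _).trans ?_
    gcongr
    · exact_mod_cast hScard
    · exact (ENNReal.sum_le_tsum _).trans (tsum_sq_le_tailSq_zero c)
  · rw [← Lp.enorm_def, one_div, ENNReal.le_rpow_inv_iff (by norm_num)]
    calc ‖h‖ₑ ^ (2 : ℝ) = ‖h‖ₑ ^ 2 := by norm_cast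
      _ ≤ _ := hhn ▸ hd2

/-! ### Dyadic levels of a weight and block forms of weighted norms. -/

theorem eLpNorm_const_mul {X : Type*} [MeasurableSpace X] {μ : Measure X} (f : X → ℝ≥0∞)
    {a : ℝ≥0∞} (ha : a ≠ ∞) {p : ℝ≥0∞} (hp0 : p ≠ 0) :
    eLpNorm (fun x => a * f x) p μ = a * eLpNorm f p μ := by
  rcases eq_or_ne p ∞ with rfl | hp
  · simp only [eLpNorm_exponent_top, eLpNormEssSup_eq_essSup_enorm, enorm_eq_self]
    exact ENNReal.essSup_const_mul
  · have hp' : 0 < p.toReal := ENNReal.toReal_pos hp0 hp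
    simp only [eLpNorm_eq_lintegral_rpow_enorm_toReal hp0 hp, enorm_eq_self,
      ENNReal.mul_rpow_of_nonneg _ _ hp'.le]
    rw [lintegral_const_mul' _ _ (ENNReal.rpow_ne_top_of_nonneg hp'.le ha),
      ENNReal.mul_rpow_of_nonneg _ _ (by positivity), ← ENNReal.rpow_mul,
      mul_one_div_cancel hp'.ne', ENNReal.rpow_one]

/-- The dyadic level of a real number `x ≥ 1`. -/
def level (x : ℝ) : ℕ := Nat.log 2 ⌊x⌋₊

theorem measurable_level : Measurable level :=
  (measurable_from_top (f := fun n : ℕ => Nat.log 2 n)).comp Nat.measurable_floor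

theorem pow_level_le {x : ℝ} (hx : 1 ≤ x) : (2 : ℝ) ^ level x ≤ x := by
  have h : ⌊x⌋₊ ≠ 0 := (Nat.floor_pos.2 hx).ne'
  calc (2 : ℝ) ^ level x ≤ (⌊x⌋₊ : ℝ) := by exact_mod_cast Nat.pow_log_le_self 2 h
    _ ≤ x := Nat.floor_le (by linarith)

theorem lt_pow_level_succ {x : ℝ} (hx : 1 ≤ x) : x < (2 : ℝ) ^ (level x + 1) := by
  have h : ⌊x⌋₊ < 2 ^ (level x + 1) := Nat.lt_pow_succ_log_self (by norm_num) _
  have := (Nat.floor_lt (by linarith)).1 h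
  exact_mod_cast this

theorem le_level_iff {x : ℝ} (hx : 1 ≤ x) (n : ℕ) : n ≤ level x ↔ (2 : ℝ) ^ n ≤ x := by
  constructor
  · intro h
    exact (pow_le_pow_right₀ (by norm_num) h).trans (pow_level_le hx)
  · intro h
    by_contra! hlt
    have h1 : (2 : ℝ) ^ (level x + 1) ≤ 2 ^ n := pow_le_pow_right₀ (by norm_num) hlt
    linarith [lt_pow_level_succ hx]

theorem rpow_anti_of_neg {a b : ℝ≥0∞} (hab : a ≤ b) {β : ℝ} (hβ : β < 0) : b ^ β ≤ a ^ β := by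
  have := ENNReal.rpow_le_rpow hab (neg_nonneg.2 hβ.le)
  rw [ENNReal.rpow_neg, ENNReal.rpow_neg] at this
  exact ENNReal.inv_le_inv.1 this

/-- The absolute value in the constant lets the comparison hold for either sign of the exponent,
since the logarithmic exponents may be negative. -/
theorem rpow_le_of_le_two_mul {a b : ℝ≥0∞} (hat : a ≠ ∞) (hab : a ≤ b)
    (hba : b ≤ 2 * a) (β : ℝ) : b ^ β ≤ 2 ^ |β| * a ^ β ∧ a ^ β ≤ 2 ^ |β| * b ^ β := by
  have h2 : ∀ x : ℝ≥0∞, x ≤ 2 ^ |β| * x := fun x => by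
    have : (1 : ℝ≥0∞) ≤ 2 ^ |β| := by
      simpa using ENNReal.rpow_le_rpow (x := 1) (y := 2) (by norm_num) (abs_nonneg β)
    calc x = 1 * x := (one_mul x).symm
      _ ≤ _ := by gcongr
  rcases le_or_gt 0 β with hβ | hβ
  · refine ⟨?_, (ENNReal.rpow_le_rpow hab hβ).trans (h2 _)⟩
    rw [abs_of_nonneg hβ, ← ENNReal.mul_rpow_of_nonneg _ _ hβ]
    exact ENNReal.rpow_le_rpow hba hβ
  · refine ⟨(rpow_anti_of_neg hab hβ).trans (h2 _), ?_⟩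
    calc a ^ β = 2 ^ |β| * (2 * a) ^ β := by
          rw [ENNReal.mul_rpow_of_ne_top (by norm_num) hat, ← mul_assoc,
            ← ENNReal.rpow_add _ _ (by norm_num) (by norm_num), abs_of_neg hβ]
          simp
      _ ≤ _ := mul_le_mul' le_rfl (rpow_anti_of_neg hba hβ)

theorem ofReal_rpow_level {x : ℝ} (hx : 1 ≤ x) (β : ℝ) :
    ENNReal.ofReal x ^ β ≤ 2 ^ |β| * 2 ^ (level x * β) ∧
      (2 : ℝ≥0∞) ^ (level x * β) ≤ 2 ^ |β| * ENNReal.ofReal x ^ β := by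
  have e : (2 : ℝ≥0∞) ^ (level x : ℝ) = ENNReal.ofReal (2 ^ level x) := by
    rw [ENNReal.ofReal_pow (by norm_num), ENNReal.rpow_natCast]
    simp
  rw [ENNReal.rpow_mul, e]
  refine rpow_le_of_le_two_mul ENNReal.ofReal_ne_top
    (ENNReal.ofReal_le_ofReal (pow_level_le hx)) ?_ β
  have : (2 : ℝ≥0∞) = ENNReal.ofReal 2 := by simp
  rw [this, ← ENNReal.ofReal_mul (by norm_num), ← pow_succ']
  exact ENNReal.ofReal_le_ofReal (lt_pow_level_succ hx).le

section Blocks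

variable {X : Type*} [MeasurableSpace X]

/-- The block of `l` at level `m`. -/
def block (l : X → ℝ) (m : ℕ) : Set X := (fun x => level (l x)) ⁻¹' {m}

theorem measurableSet_block {l : X → ℝ} (hl : Measurable l) (m : ℕ) : MeasurableSet (block l m) :=
  measurable_level.comp hl (measurableSet_singleton m)

/-- On one block the weight is constant up to the factor `2 ^ |β|`, so it can be pulled out as `2 ^
(m * β)`. The companion lemma is the reverse estimate. -/
theorem eLpNorm_weight_le_block (ν : Measure X) {l : X → ℝ} (hl : Measurable l)
    (hl1 : ∀ x, 1 ≤ l x) (g : X → ℝ≥0∞) {p : ℝ≥0∞} (hp0 : p ≠ 0) (β : ℝ) :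
    eLpNorm (fun x => ENNReal.ofReal (l x) ^ β * g x) p ν ≤
      2 ^ |β| * eLpNorm (fun m : ℕ => (2 : ℝ≥0∞) ^ (m * β) * eLpNorm g p (ν.restrict (block l m)))
        p Measure.count := by
  have ht : ∀ b : ℝ, (2 : ℝ≥0∞) ^ b ≠ ∞ := fun b =>
    ENNReal.rpow_ne_top_of_ne_zero (by norm_num) (by norm_num)
  rw [eLpNorm_eq_eLpNorm_fiber ν _ hp0 (measurable_level.comp hl), ← eLpNorm_const_mul _ (ht _) hp0]
  refine eLpNorm_mono_enorm fun m => ?_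
  simp only [enorm_eq_self]
  rw [← eLpNorm_const_mul _ (ht _) hp0, ← eLpNorm_const_mul _ (ht _) hp0]
  refine eLpNorm_mono_enorm_ae ?_
  filter_upwards [ae_restrict_mem (measurableSet_block hl m)] with x hx
  simp only [enorm_eq_self]
  rw [← mul_assoc]
  gcongr
  have hx' : level (l x) = m := hx
  rw [← hx']
  exact (ofReal_rpow_level (hl1 x) β).1

theorem eLpNorm_block_le_weight (ν : Measure X) {l : X → ℝ} (hl : Measurable l)
    (hl1 : ∀ x, 1 ≤ l x) (g : X → ℝ≥0∞) {p : ℝ≥0∞} (hp0 : p ≠ 0) (β : ℝ) :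
    eLpNorm (fun m : ℕ => (2 : ℝ≥0∞) ^ (m * β) * eLpNorm g p (ν.restrict (block l m)))
        p Measure.count ≤
      2 ^ |β| * eLpNorm (fun x => ENNReal.ofReal (l x) ^ β * g x) p ν := by
  have ht : ∀ b : ℝ, (2 : ℝ≥0∞) ^ b ≠ ∞ := fun b =>
    ENNReal.rpow_ne_top_of_ne_zero (by norm_num) (by norm_num)
  rw [eLpNorm_eq_eLpNorm_fiber ν _ hp0 (measurable_level.comp hl), ← eLpNorm_const_mul _ (ht _) hp0]
  refine eLpNorm_mono_enorm fun m => ?_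
  simp only [enorm_eq_self]
  rw [← eLpNorm_const_mul _ (ht _) hp0, ← eLpNorm_const_mul _ (ht _) hp0]
  refine eLpNorm_mono_enorm_ae ?_
  filter_upwards [ae_restrict_mem (measurableSet_block hl m)] with x hx
  simp only [enorm_eq_self]
  rw [← mul_assoc]
  gcongr
  have hx' : level (l x) = m := hx
  rw [← hx']
  exact (ofReal_rpow_level (hl1 x) β).2

end Blocks

/-! ### Function norms compared with the block sequence. -/

section Time

/-- `1 + |log t|` -/
def logWeight (t : ℝ) : ℝ := 1 + |Real.log t|

theorem one_le_logWeight (t : ℝ) : 1 ≤ logWeight t := by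
  unfold logWeight; linarith [abs_nonneg (Real.log t)]

theorem measurable_logWeight : Measurable logWeight := by
  unfold logWeight
  exact measurable_const.add Real.measurable_log.norm

/-- The measure `dt / t` on `(0, 1)`. -/
def haar01 : Measure ℝ :=
  (volume.restrict (Ioo 0 1)).withDensity fun t => (ENNReal.ofReal t)⁻¹

theorem measurable_inv_ofReal : Measurable fun t : ℝ => (ENNReal.ofReal t)⁻¹ :=
  ENNReal.measurable_ofReal.inv

/-- The measure `dt / t` absorbs the power weights. -/
theorem eLpNorm_haar01_restrict (s : Set ℝ) (hs : MeasurableSet s) (g : ℝ → ℝ≥0∞) {p : ℝ≥0∞}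
    (hp0 : p ≠ 0) :
    eLpNorm g p (haar01.restrict s) =
      eLpNorm (fun t => (ENNReal.ofReal t)⁻¹ ^ recip p * g t) p
        ((volume.restrict (Ioo 0 1)).restrict s) := by
  rw [haar01, restrict_withDensity hs, eLpNorm_rpow_recip_mul measurable_inv_ofReal _ _ hp0]
  · exact Filter.Eventually.of_forall fun x => by simp
  · refine ae_restrict_of_ae ?_
    filter_upwards [ae_restrict_mem measurableSet_Ioo] with t ht
    simpa using ht.1

theorem recip_two : recip 2 = 1 / 2 := by simp [recip]

theorem lzNorm_two_eq {p : ℝ≥0∞} (hp0 : p ≠ 0) (β : ℝ) (f : ℝ → ℂ) :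
    lzNorm 2 p β f = eLpNorm (fun t => ENNReal.ofReal (logWeight t) ^ β *
      (ENNReal.ofReal t ^ (1 / 2 : ℝ) * rearr f t)) p haar01 := by
  rw [← Measure.restrict_univ (μ := haar01), eLpNorm_haar01_restrict _ .univ _ hp0,
    Measure.restrict_univ]
  refine eLpNorm_congr_ae ?_
  filter_upwards [ae_restrict_mem measurableSet_Ioo] with t ht
  have h0 : 0 < ENNReal.ofReal t := ENNReal.ofReal_pos.2 ht.1
  rw [ENNReal.ofReal_mul (Real.rpow_nonneg ht.1.le _), ← ENNReal.ofReal_rpow_of_pos ht.1,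
    ← logWeight, ← ENNReal.ofReal_rpow_of_pos (zero_lt_one.trans_le (one_le_logWeight t)), recip_two,
    sub_eq_add_neg, ENNReal.rpow_add _ _ h0.ne' ENNReal.ofReal_ne_top, ENNReal.inv_rpow,
    ENNReal.rpow_neg]
  ring

theorem limNorm_two_eq {q : ℝ≥0∞} (hq0 : q ≠ 0) (α : ℝ) (f : ℝ → ℂ) :
    limNorm 2 q α 2 f = eLpNorm (fun t => ENNReal.ofReal (logWeight t) ^ α * partialL2 f t)
      q haar01 := by
  rw [← Measure.restrict_univ (μ := haar01), eLpNorm_haar01_restrict _ .univ _ hq0,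
    Measure.restrict_univ]
  refine eLpNorm_congr_ae ?_
  filter_upwards [ae_restrict_mem measurableSet_Ioo] with t ht
  rw [ENNReal.ofReal_mul (Real.rpow_nonneg ht.1.le _), ← ENNReal.ofReal_rpow_of_pos ht.1,
    ← logWeight, ← ENNReal.ofReal_rpow_of_pos (zero_lt_one.trans_le (one_le_logWeight t)),
    ENNReal.inv_rpow,
    ENNReal.rpow_neg]
  simp only [sub_self, Real.rpow_zero, ENNReal.ofReal_one, one_mul, partialL2]
  ring

/-- The right endpoint of the `m`-th block of `(0, 1)`. -/
def blockTime (m : ℕ) : ℝ := Real.exp (1 - 2 ^ m)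

theorem mem_Ioc_of_mem_block {m : ℕ} {t : ℝ} (ht : t ∈ Ioo (0 : ℝ) 1)
    (hm : t ∈ block logWeight m) : t ∈ Ioc (blockTime (m + 1)) (blockTime m) := by
  have hm' : level (logWeight t) = m := hm
  have h1 := pow_level_le (one_le_logWeight t)
  have h2 := lt_pow_level_succ (one_le_logWeight t)
  rw [hm'] at h1 h2
  have h3 : logWeight t = 1 - Real.log t := by
    rw [logWeight, abs_of_nonpos (Real.log_nonpos ht.1.le ht.2.le)]; ring
  rw [h3] at h1 h2
  constructor
  · rw [blockTime, ← Real.lt_log_iff_exp_lt ht.1]; linarith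
  · rw [blockTime, ← Real.log_le_iff_le_exp ht.1]; linarith

theorem lintegral_Ioc_inv {a b : ℝ} (ha : 0 < a) (hab : a ≤ b) :
    ∫⁻ t in Ioc a b, (ENNReal.ofReal t)⁻¹ = ENNReal.ofReal (Real.log (b / a)) := by
  have h0 : ∀ t ∈ Ioc a b, 0 < t := fun t ht => ha.trans ht.1
  rw [← integral_inv_of_pos ha (ha.trans_le hab), intervalIntegral.integral_of_le hab,
    ofReal_integral_eq_lintegral_ofReal]
  · refine setLIntegral_congr_fun measurableSet_Ioc fun t ht => ?_
    exact (ENNReal.ofReal_inv_of_pos (h0 t ht)).symm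
  · have : IntervalIntegrable (fun t : ℝ => t⁻¹) volume a b :=
      intervalIntegral.intervalIntegrable_inv (fun x hx => by
        rw [uIcc_of_le hab] at hx; exact (ha.trans_le hx.1).ne') continuousOn_id
    exact (intervalIntegrable_iff_integrableOn_Ioc_of_le hab).1 this
  · filter_upwards [ae_restrict_mem measurableSet_Ioc] with t ht
    exact (inv_pos.2 (h0 t ht)).le

theorem measurableSet_logBlock (m : ℕ) : MeasurableSet (block logWeight m) :=
  measurableSet_block measurable_logWeight m

theorem restrict_logBlock_le (m : ℕ) :
    (volume.restrict (Ioo 0 1)).restrict (block logWeight m) ≤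
      volume.restrict (Ioc (blockTime (m + 1)) (blockTime m)) := by
  rw [Measure.restrict_restrict (measurableSet_logBlock m)]
  exact Measure.restrict_mono (fun t ht => mem_Ioc_of_mem_block ht.2 ht.1) le_rfl

/-- The `dt / t`-measure of an interval is the logarithm of the ratio of its endpoints, here 2^{m+1}
- 2^m. -/
theorem haar01_block_le (m : ℕ) : haar01 (block logWeight m) ≤ 2 ^ (m : ℝ) := by
  rw [haar01, withDensity_apply _ (measurableSet_logBlock m)]
  refine (lintegral_mono' (restrict_logBlock_le m) le_rfl).trans ?_
  have hle : blockTime (m + 1) ≤ blockTime m := by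
    unfold blockTime
    gcongr <;> simp
  rw [lintegral_Ioc_inv (a := blockTime (m + 1)) (Real.exp_pos _) hle, blockTime, blockTime,
    ← Real.exp_sub, Real.log_exp, ENNReal.rpow_natCast]
  refine le_of_eq ?_
  rw [show (1 - 2 ^ m - (1 - 2 ^ (m + 1)) : ℝ) = 2 ^ m by ring, ENNReal.ofReal_pow (by norm_num)]
  simp

theorem eLpNorm_two_block_le (f : ℝ → ℂ) (m : ℕ) :
    eLpNorm (fun t => ENNReal.ofReal t ^ (1 / 2 : ℝ) * rearr f t) 2
      (haar01.restrict (block logWeight m)) ≤ partialL2 f (blockTime m) := by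
  rw [eLpNorm_haar01_restrict _ (measurableSet_logBlock m) _ (by norm_num)]
  calc _ = eLpNorm (rearr f) 2 ((volume.restrict (Ioo 0 1)).restrict (block logWeight m)) := by
        refine eLpNorm_congr_ae (ae_restrict_of_ae ?_)
        filter_upwards [ae_restrict_mem measurableSet_Ioo] with t ht
        have h0 : 0 < ENNReal.ofReal t := ENNReal.ofReal_pos.2 ht.1
        rw [recip_two, ← mul_assoc, ENNReal.inv_rpow, ENNReal.inv_mul_cancel, one_mul]
        · simp [ht.1]
        · exact ENNReal.rpow_ne_top_of_nonneg (by norm_num) ENNReal.ofReal_ne_top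
    _ ≤ eLpNorm (rearr f) 2 (volume.restrict (Ioc (blockTime (m + 1)) (blockTime m))) :=
        eLpNorm_mono_measure _ (restrict_logBlock_le m)
    _ ≤ eLpNorm (rearr f) 2 (volume.restrict (Ioc 0 (blockTime m))) :=
        eLpNorm_mono_measure _
          (Measure.restrict_mono (Ioc_subset_Ioc_left (Real.exp_pos _).le) le_rfl)
    _ = _ := by rw [partialL2, Measure.restrict_congr_set Ioo_ae_eq_Ioc]

/-- Since f* is non-increasing, it is at least f*(t) on `(0, t)`. -/
theorem sqrt_mul_rearr_le (f : ℝ → ℂ) (t : ℝ) :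
    ENNReal.ofReal t ^ (1 / 2 : ℝ) * rearr f t ≤ partialL2 f t := by
  calc ENNReal.ofReal t ^ (1 / 2 : ℝ) * rearr f t
      = eLpNorm (fun _ => rearr f t) 2 (volume.restrict (Ioo 0 t)) := by
        rw [eLpNorm_eq_lintegral_rpow_enorm_toReal (by simp) (by simp)]
        simp only [enorm_eq_self, lintegral_const, Measure.restrict_apply_univ, Real.volume_Ioo,
          sub_zero, ENNReal.toReal_ofNat]
        rw [ENNReal.mul_rpow_of_nonneg _ _ (by norm_num), ← ENNReal.rpow_mul, mul_comm]
        norm_num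
    _ ≤ _ := by
        refine eLpNorm_mono_enorm_ae ?_
        filter_upwards [ae_restrict_mem measurableSet_Ioo] with u hu
        exact rearr_antitone f hu.2.le

/-- The block sequence to which all norms of functions are compared. -/
def blockNorm (q : ℝ≥0∞) (γ : ℝ) (f : ℝ → ℂ) : ℝ≥0∞ :=
  eLpNorm (fun m : ℕ => (2 : ℝ≥0∞) ^ (m * γ) * partialL2 f (blockTime m)) q Measure.count

theorem ae_haar01_block (m : ℕ) : ∀ᵐ t ∂(haar01.restrict (block logWeight m)),
    t ≤ blockTime m := by
  have h : ∀ᵐ t ∂haar01, t ∈ Ioo (0 : ℝ) 1 :=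
    (withDensity_absolutelyContinuous _ _).ae_le (ae_restrict_mem measurableSet_Ioo)
  filter_upwards [ae_restrict_mem (measurableSet_logBlock m), ae_restrict_of_ae h] with t h1 h2
  exact (mem_Ioc_of_mem_block h2 h1).2

theorem recip_nonneg (q : ℝ≥0∞) : 0 ≤ recip q := ENNReal.toReal_nonneg

theorem two_rpow_add (a b : ℝ) : (2 : ℝ≥0∞) ^ (a + b) = 2 ^ a * 2 ^ b :=
  ENNReal.rpow_add _ _ (by norm_num) (by norm_num)

/-- On a block `partialL2 f` is at most its value at the right endpoint; the block measure, at most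
2^m, contributes 2^{m/q} and shifts the exponent from α to α + 1/q. -/
theorem limNorm_le_blockNorm {q : ℝ≥0∞} (hq0 : q ≠ 0) (α : ℝ) (f : ℝ → ℂ) :
    limNorm 2 q α 2 f ≤ 2 ^ |α| * blockNorm q (α + recip q) f := by
  rw [limNorm_two_eq hq0]
  refine (eLpNorm_weight_le_block haar01 measurable_logWeight one_le_logWeight _ hq0 α).trans ?_
  gcongr
  refine eLpNorm_mono_enorm fun m => ?_
  simp only [enorm_eq_self]
  rw [mul_add, two_rpow_add, mul_assoc]
  gcongr
  have h := eLpNorm_le_of_ae_enorm_bound (f := partialL2 f) (C := partialL2 f (blockTime m))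
    (p := q) (μ := haar01.restrict (block logWeight m)) (by
      filter_upwards [ae_haar01_block m] with t ht
      exact partialL2_mono f ht)
  refine h.trans ?_
  rw [smul_eq_mul, mul_comm, Measure.restrict_apply_univ, ← ENNReal.toReal_inv]
  gcongr
  rw [ENNReal.rpow_mul]
  exact ENNReal.rpow_le_rpow (haar01_block_le m) (recip_nonneg q)

/-- On a block, t^{1/2} f*(t) is bounded both pointwise and in L_2 by the same number `partialL2 f
(blockTime m)`, hence in every L_p with p ≥ 2, without any factor from the block measure. The
embedding of l_q into l_p does the rest. -/
theorem lzNorm_le_blockNorm_of_two_le {q p : ℝ≥0∞} (hq0 : q ≠ 0) (hp : 2 ≤ p) (hqp : q ≤ p) (γ : ℝ)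
    (f : ℝ → ℂ) : lzNorm 2 p γ f ≤ 2 ^ |γ| * blockNorm q γ f := by
  have hp0 : p ≠ 0 := (lt_of_lt_of_le (by norm_num) hp).ne'
  rw [lzNorm_two_eq hp0]
  refine (eLpNorm_weight_le_block haar01 measurable_logWeight one_le_logWeight _ hp0 γ).trans ?_
  gcongr
  refine le_trans (eLpNorm_mono_enorm fun m => ?_) (eLpNorm_count_anti _ hq0 hqp)
  simp only [enorm_eq_self]
  gcongr
  refine eLpNorm_le_of_exponent_le_of_bound (by norm_num) hp ?_ (eLpNorm_two_block_le f m)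
  filter_upwards [ae_haar01_block m] with t ht
  exact (sqrt_mul_rearr_le f t).trans (partialL2_mono f ht)

/-- Hölder from L_2 to L_q on a block of measure at most 2^m costs 2^{m(1/q - 1/2)}, exactly the gap
between the exponents α + 1/2 and α + 1/q. -/
theorem lzNorm_le_blockNorm_of_le_two {q : ℝ≥0∞} (hq0 : q ≠ 0) (hq : q ≤ 2) (α : ℝ)
    (f : ℝ → ℂ) :
    lzNorm 2 q (α + 1 / 2) f ≤ 2 ^ |α + 1 / 2| * blockNorm q (α + recip q) f := by
  rw [lzNorm_two_eq hq0]
  refine (eLpNorm_weight_le_block haar01 measurable_logWeight one_le_logWeight _ hq0 _).trans ?_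
  gcongr
  refine eLpNorm_mono_enorm fun m => ?_
  simp only [enorm_eq_self]
  rw [show (m * (α + recip q) : ℝ) = m * (α + 1 / 2) + m * (recip q - 1 / 2) by ring,
    two_rpow_add, mul_assoc]
  gcongr
  have hm : Measurable fun t => ENNReal.ofReal t ^ (1 / 2 : ℝ) * rearr f t :=
    (ENNReal.measurable_ofReal.pow_const _).mul (rearr_antitone f).measurable
  have h := eLpNorm_le_eLpNorm_mul_rpow_measure_univ hq
    (μ := haar01.restrict (block logWeight m)) hm.aestronglyMeasurable
  refine h.trans ?_
  have hr : (1 / q.toReal - 1 / (2 : ℝ≥0∞).toReal) = recip q - 1 / 2 := by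
    simp [recip, ENNReal.toReal_inv]
  have hr0 : 0 ≤ recip q - 1 / 2 := by
    rw [← recip_two]
    exact sub_nonneg.2 (ENNReal.toReal_mono (by simpa using hq0) (ENNReal.inv_le_inv.2 hq))
  rw [hr, mul_comm, Measure.restrict_apply_univ, ENNReal.rpow_mul]
  exact mul_le_mul' (ENNReal.rpow_le_rpow (haar01_block_le m) hr0) (eLpNorm_two_block_le f m)

end Time

/-! ### Shifts and initial segments in `l_p`. -/

theorem eLpNorm_count_comp_le (y : ℕ → ℝ≥0∞) {p : ℝ≥0∞} (hp0 : p ≠ 0) {e : ℕ → ℕ}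
    (he : Function.Injective e) :
    eLpNorm (fun n => y (e n)) p Measure.count ≤ eLpNorm y p Measure.count := by
  rcases eq_or_ne p ∞ with rfl | hp
  · simp only [eLpNorm_exponent_top, eLpNormEssSup_count, enorm_eq_self]
    exact iSup_comp_le y e
  · simp only [eLpNorm_eq_lintegral_rpow_enorm_toReal hp0 hp, enorm_eq_self, lintegral_count]
    exact ENNReal.rpow_le_rpow (ENNReal.tsum_comp_le_tsum_of_injective he fun n => y n ^ p.toReal)
      (by positivity)

theorem eLpNorm_count_le_add_succ (y : ℕ → ℝ≥0∞) {p : ℝ≥0∞} (hp1 : 1 ≤ p) :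
    eLpNorm y p Measure.count ≤ y 0 + eLpNorm (fun n => y (n + 1)) p Measure.count := by
  have hp0 : p ≠ 0 := (zero_lt_one.trans_le hp1).ne'
  rcases eq_or_ne p ∞ with rfl | hp
  · simp only [eLpNorm_exponent_top, eLpNormEssSup_count, enorm_eq_self]
    refine iSup_le fun n => ?_
    cases n with
    | zero => exact le_self_add
    | succ n => exact (le_iSup (fun n => y (n + 1)) n).trans le_add_self
  · have hp' : 0 < p.toReal := ENNReal.toReal_pos hp0 hp
    have h1 : 1 ≤ p.toReal := by simpa using ENNReal.toReal_mono hp hp1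
    simp only [eLpNorm_eq_lintegral_rpow_enorm_toReal hp0 hp, enorm_eq_self, lintegral_count]
    rw [tsum_eq_zero_add' ENNReal.summable]
    have h := ENNReal.rpow_add_rpow_le_add (y 0) ((∑' n, y (n + 1) ^ p.toReal) ^ (1 / p.toReal)) h1
    rwa [← ENNReal.rpow_mul (∑' n, y (n + 1) ^ p.toReal), one_div_mul_cancel hp'.ne',
      ENNReal.rpow_one] at h

theorem eLpNorm_count_le_sum_add (y : ℕ → ℝ≥0∞) {p : ℝ≥0∞} (hp1 : 1 ≤ p) (k : ℕ) :
    eLpNorm y p Measure.count ≤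
      ∑ m ∈ Finset.range k, y m + eLpNorm (fun n => y (n + k)) p Measure.count := by
  induction k with
  | zero => simp
  | succ k ih =>
    refine ih.trans ?_
    rw [Finset.sum_range_succ, add_assoc]
    gcongr
    refine (eLpNorm_count_le_add_succ _ hp1).trans (le_of_eq ?_)
    simp only [zero_add, add_right_comm, add_assoc]

theorem eLpNorm_count_le_tsum (y : ℕ → ℝ≥0∞) {p : ℝ≥0∞} (hp1 : 1 ≤ p) :
    eLpNorm y p Measure.count ≤ ∑' n, y n := by
  refine (eLpNorm_count_anti y one_ne_zero hp1).trans (le_of_eq ?_)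
  simp [eLpNorm_one_eq_lintegral_enorm, lintegral_count]

/-! ### Coefficient tails and blocks. -/

section SeqBlocks

variable {ι : Type} (c : ι → ℂ)

/-- `1 + log k` with `k = j + 1` -/
def seqWeight (j : ℕ) : ℝ := 1 + Real.log ((j : ℝ) + 1)

theorem one_le_seqWeight (j : ℕ) : 1 ≤ seqWeight j := by
  have : 0 ≤ Real.log ((j : ℝ) + 1) := Real.log_nonneg (by linarith [Nat.cast_nonneg (α := ℝ) j])
  unfold seqWeight; linarith

/-- The `l_2`-norm of the rearrangement over a block. -/
def blockL2 (i : ℕ) : ℝ≥0∞ :=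
  eLpNorm (seqRearr c) 2 (Measure.count.restrict (block seqWeight i))

/-- The sum of the `l_2`-norms over the blocks from the `n`-th on. -/
def tailL2 (n : ℕ) : ℝ≥0∞ := ∑' i, blockL2 c (n + i)

theorem tailSq_rpow_eq (K : ℕ) :
    tailSq c K ^ (1 / 2 : ℝ) = eLpNorm (fun k => seqRearr c (k + K)) 2 Measure.count := by
  rw [eLpNorm_eq_lintegral_rpow_enorm_toReal (by simp) (by simp)]
  simp [lintegral_count, tailSq]

/-- Every index from `K` on lies in a block of level at least `n`. The l_2-sum of the block norms is
then weakened to an l_1-sum, the form that Hardy's inequality takes. -/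
theorem tailSq_rpow_le_tailL2 {K n : ℕ} (h : (2 : ℝ) ^ n ≤ seqWeight K) :
    tailSq c K ^ (1 / 2 : ℝ) ≤ tailL2 c n := by
  set S : Set ℕ := ⋃ i, block seqWeight (n + i) with hS
  have hmem : ∀ k, k + K ∈ S := fun k => by
    have h1 : seqWeight K ≤ seqWeight (k + K) := by
      unfold seqWeight
      gcongr
      simp
    have h2 := (le_level_iff (one_le_seqWeight (k + K)) n).2 (h.trans h1)
    refine mem_iUnion.2 ⟨level (seqWeight (k + K)) - n, ?_⟩
    change level (seqWeight (k + K)) = _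
    omega
  calc tailSq c K ^ (1 / 2 : ℝ)
      = eLpNorm (fun k => S.indicator (seqRearr c) (k + K)) 2 Measure.count := by
        rw [tailSq_rpow_eq]
        congr
        ext k
        rw [indicator_of_mem (hmem k)]
    _ ≤ eLpNorm (S.indicator (seqRearr c)) 2 Measure.count :=
        eLpNorm_count_comp_le _ (by norm_num) (add_left_injective K)
    _ = eLpNorm (seqRearr c) 2 (Measure.count.restrict S) :=
        eLpNorm_indicator_eq_eLpNorm_restrict MeasurableSpace.measurableSet_top
    _ = eLpNorm (fun i => blockL2 c (n + i)) 2 Measure.count := by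
        rw [hS, Measure.restrict_iUnion _ fun _ => MeasurableSpace.measurableSet_top,
          eLpNorm_sum_measure _ _ (by norm_num)]
        · rfl
        · intro i j hij
          exact Disjoint.preimage _ (by simpa using hij)
    _ ≤ _ := eLpNorm_count_le_tsum _ (by norm_num)

end SeqBlocks

/-! ### The estimate along the block endpoints. -/

theorem exists_rpow_mul_exp_le (γ : ℝ) : ∃ C : ℝ≥0, ∀ n : ℕ,
    (2 : ℝ≥0∞) ^ (n * γ) * ENNReal.ofReal (Real.exp (-(1 / 2) * 2 ^ n)) ≤ C * 2⁻¹ ^ n := by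
  have h1 := tendsto_rpow_mul_exp_neg_mul_atTop_nhds_zero (γ + 1) (1 / 2) (by norm_num)
  have h2 := h1.comp (tendsto_pow_atTop_atTop_of_one_lt (r := (2 : ℝ)) (by norm_num))
  obtain ⟨C, hC⟩ := h2.bddAbove_range
  refine ⟨C.toNNReal, fun n => ?_⟩
  have h3 : ((2 : ℝ) ^ n) ^ (γ + 1) * Real.exp (-(1 / 2) * 2 ^ n) ≤ C :=
    hC ⟨n, rfl⟩
  have e1 : (2 : ℝ≥0∞) ^ (n * γ) = ENNReal.ofReal (((2 : ℝ) ^ n) ^ γ) := by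
    rw [← ENNReal.ofReal_rpow_of_pos (by positivity), ENNReal.ofReal_pow (by norm_num),
      ENNReal.rpow_mul, ENNReal.rpow_natCast]
    simp
  have e2 : (2⁻¹ : ℝ≥0∞) ^ n = ENNReal.ofReal ((2 ^ n)⁻¹) := by
    rw [ENNReal.ofReal_inv_of_pos (by positivity), ENNReal.ofReal_pow (by norm_num),
      ENNReal.inv_pow]
    simp
  rw [e1, e2, ← ENNReal.ofReal_mul (by positivity),
    show ((C.toNNReal : ℝ≥0) : ℝ≥0∞) = ENNReal.ofReal C from rfl,
    ← ENNReal.ofReal_mul' (by positivity)]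
  refine ENNReal.ofReal_le_ofReal ?_
  rw [← div_eq_mul_inv, le_div_iff₀ (by positivity)]
  calc _ = ((2 : ℝ) ^ n) ^ (γ + 1) * Real.exp (-(1 / 2) * 2 ^ n) := by
        rw [Real.rpow_add_one (by positivity)]; ring
    _ ≤ C := h3

theorem exists_sum_two_rpow_le {γ : ℝ} (hγ : 0 < γ) : ∃ C : ℝ≥0, ∀ k : ℕ,
    ∑ m ∈ Finset.range k, (2 : ℝ≥0∞) ^ (m * γ) ≤ C * 2 ^ (k * γ) := by
  have h1 : (1 : ℝ) < 2 ^ γ := Real.one_lt_rpow (by norm_num) hγ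
  -- Chosen so that A 2^γ = A + 1, which makes the induction on the geometric sum close exactly.
  set A : ℝ := 1 / (2 ^ γ - 1) with hA
  have hA0 : 0 < A := div_pos one_pos (by linarith)
  have hA1 : A * 2 ^ γ = A + 1 := by
    have : (2 : ℝ) ^ γ - 1 ≠ 0 := by linarith
    rw [hA]
    field_simp
    ring
  have hE : ENNReal.ofReal A * 2 ^ γ = ENNReal.ofReal A + 1 := by
    have : (2 : ℝ≥0∞) ^ γ = ENNReal.ofReal (2 ^ γ) := by
      rw [← ENNReal.ofReal_rpow_of_pos (by norm_num)]; simp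
    rw [this, ← ENNReal.ofReal_mul hA0.le, hA1, ENNReal.ofReal_add hA0.le (by norm_num),
      ENNReal.ofReal_one]
  refine ⟨A.toNNReal, fun k => ?_⟩
  change _ ≤ ENNReal.ofReal A * _
  induction k with
  | zero => simp
  | succ k ih =>
    rw [Finset.sum_range_succ]
    calc _ ≤ ENNReal.ofReal A * 2 ^ (k * γ) + 2 ^ (k * γ) := by gcongr
      _ = (ENNReal.ofReal A * 2 ^ γ) * 2 ^ (k * γ) := by rw [hE]; ring
      _ = _ := by
        rw [mul_assoc, ← two_rpow_add]
        push_cast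
        ring_nf

/-- The main part of the basic estimate at the block endpoints. -/
theorem head_coeff_le {M : ℝ≥0} (hM : 1 ≤ M) {n : ℕ} (hn : 1 + Real.log M ≤ 2 ^ n) :
    (M : ℝ≥0∞) * (2 * (⌈Real.exp (2 ^ n - 1)⌉₊ : ℕ) : ℝ≥0∞) ^ (1 / 2 : ℝ) *
      ENNReal.ofReal (blockTime (n + 2)) ^ (1 / 2 : ℝ) ≤
      2 * ENNReal.ofReal (Real.exp (-(1 / 2) * 2 ^ n)) := by
  set x : ℝ := 2 ^ n with hx
  have hx1 : 1 ≤ x := one_le_pow₀ (by norm_num)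
  have hM0 : (0 : ℝ) < M := by exact_mod_cast zero_lt_one.trans_le hM
  have hMe : (M : ℝ) ≤ Real.exp (x - 1) := by
    rw [← Real.log_le_iff_le_exp hM0]; linarith
  have hK : (2 * (⌈Real.exp (x - 1)⌉₊ : ℕ) : ℝ) ≤ 4 * Real.exp (x - 1) := by
    have h1 := Nat.ceil_lt_add_one (Real.exp_pos (x - 1)).le
    have h2 : 1 ≤ Real.exp (x - 1) := Real.one_le_exp (by linarith)
    linarith
  have hT : blockTime (n + 2) = Real.exp (1 - 4 * x) := by
    rw [blockTime, pow_add, ← hx]; ring_nf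
  have e1 : (M : ℝ≥0∞) = ENNReal.ofReal M := (ENNReal.ofReal_coe_nnreal).symm
  have e2 : (2 * (⌈Real.exp (x - 1)⌉₊ : ℕ) : ℝ≥0∞) =
      ENNReal.ofReal (2 * (⌈Real.exp (x - 1)⌉₊ : ℕ) : ℝ) := by
    rw [ENNReal.ofReal_mul (by norm_num)]; simp
  have e3 : (2 : ℝ≥0∞) = ENNReal.ofReal 2 := by simp
  rw [e1, e2, e3, ← ENNReal.ofReal_mul (by norm_num), hT,
    ENNReal.ofReal_rpow_of_nonneg (by positivity) (by norm_num),
    ENNReal.ofReal_rpow_of_nonneg (Real.exp_pos _).le (by norm_num),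
    ← ENNReal.ofReal_mul (by positivity), ← ENNReal.ofReal_mul (by positivity)]
  refine ENNReal.ofReal_le_ofReal ?_
  have h4 : (4 * Real.exp (x - 1)) ^ (1 / 2 : ℝ) = 2 * Real.exp ((x - 1) / 2) := by
    rw [Real.mul_rpow (by norm_num) (Real.exp_pos _).le, ← Real.exp_mul,
      show (4 : ℝ) = 2 ^ (2 : ℝ) by norm_num, ← Real.rpow_mul (by norm_num)]
    norm_num
    ring_nf
  calc (M : ℝ) * (2 * (⌈Real.exp (x - 1)⌉₊ : ℕ) : ℝ) ^ (1 / 2 : ℝ) *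
        Real.exp (1 - 4 * x) ^ (1 / 2 : ℝ)
      ≤ Real.exp (x - 1) * (4 * Real.exp (x - 1)) ^ (1 / 2 : ℝ) *
        Real.exp (1 - 4 * x) ^ (1 / 2 : ℝ) := by gcongr
    _ = 2 * Real.exp ((x - 1) + (x - 1) / 2 + (1 - 4 * x) * (1 / 2)) := by
        rw [h4, ← Real.exp_mul, Real.exp_add, Real.exp_add]; ring
    -- The exponent equals -x/2 - 1. Going two levels down, to t = exp(1 - 4x), is what outweighs
    -- the growth exp(3(x - 1)/2) coming from M and K.
    _ ≤ 2 * Real.exp (-(1 / 2) * x) := by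
        gcongr
        linarith

/-- The block norm of the sum is controlled by the block norm of the tails. -/
theorem exists_blockNorm_le {γ : ℝ} (hγ : 0 < γ) : ∃ C : ℝ≥0, ∀ {ι : Type} (c : ι → ℂ)
    (f : ℝ → ℂ) (M : ℝ≥0) (q : ℝ≥0∞), 1 ≤ M → 1 ≤ q →
    (∀ (t : ℝ) (K : ℕ), partialL2 f t ≤ M * (2 * K : ℝ≥0∞) ^ (1 / 2 : ℝ) *
      tailSq c 0 ^ (1 / 2 : ℝ) * ENNReal.ofReal t ^ (1 / 2 : ℝ) +
        (2 * tailSq c K) ^ (1 / 2 : ℝ)) →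
    blockNorm q γ f ≤ C * ENNReal.ofReal ((1 + Real.log M) ^ γ) *
      eLpNorm (fun n : ℕ => (2 : ℝ≥0∞) ^ (n * γ) * tailL2 c n) q Measure.count := by
  obtain ⟨A, hA⟩ := exists_sum_two_rpow_le hγ
  obtain ⟨B, hB⟩ := exists_rpow_mul_exp_le γ
  have hfin : ∀ a : ℝ, (2 : ℝ≥0∞) ^ a ≠ ∞ := fun a =>
    ENNReal.rpow_ne_top_of_ne_zero (by norm_num) (by norm_num)
  -- The first summand comes from the levels below `n₀ + 2`; in the second, `2 * B * 2` comes from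
  -- the exponential error and the last 2 from the coefficient tails.
  set D : ℝ≥0∞ := 2 * A * 2 ^ (3 * γ) + 2 ^ (2 * γ) * (2 * B * 2 + 2) with hD
  have hDt : D ≠ ∞ := by
    have h1 := hfin (3 * γ)
    have h2 := hfin (2 * γ)
    rw [hD]
    finiteness
  refine ⟨D.toNNReal, fun {ι} c f M q hM hq hf => ?_⟩
  rw [ENNReal.coe_toNNReal hDt]
  set Y := eLpNorm (fun n : ℕ => (2 : ℝ≥0∞) ^ (n * γ) * tailL2 c n) q Measure.count with hY
  have hq0 : q ≠ 0 := (zero_lt_one.trans_le hq).ne'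
  have hlog : 0 ≤ Real.log M := Real.log_nonneg (by exact_mod_cast hM)
  set x : ℝ := 1 + Real.log M with hx
  have hx1 : 1 ≤ x := by linarith
  have hsq2 : (2 : ℝ≥0∞) ^ (1 / 2 : ℝ) ≤ 2 := by
    simpa using ENNReal.rpow_le_rpow_of_exponent_le (x := 2) (by norm_num)
      (show (1 / 2 : ℝ) ≤ 1 by norm_num)
  have hpos : (0 : ℝ) ≤ 1 / 2 := by norm_num
  have h0Y : tailSq c 0 ^ (1 / 2 : ℝ) ≤ Y := by
    refine (tailSq_rpow_le_tailL2 c (n := 0) (by simpa using one_le_seqWeight 0)).trans ?_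
    simpa using le_eLpNorm_count (fun n : ℕ => (2 : ℝ≥0∞) ^ (n * γ) * tailL2 c n) hq0 0
  have hcrude : ∀ t, partialL2 f t ≤ 2 * Y := fun t => by
    -- With `K = 0` nothing is split off, so no factor `M` appears.
    refine (hf t 0).trans ?_
    rw [Nat.cast_zero, mul_zero, ENNReal.zero_rpow_of_pos (by norm_num), mul_zero, zero_mul,
      zero_mul, zero_add, ENNReal.mul_rpow_of_nonneg _ _ hpos]
    gcongr
  -- From this level on, 1 + log M ≤ 2^n, as `head_coeff_le` requires.
  set n₀ : ℕ := level x + 1 with hn₀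
  have hfine : ∀ k : ℕ, partialL2 f (blockTime (k + n₀ + 2)) ≤
      2 * ENNReal.ofReal (Real.exp (-(1 / 2) * 2 ^ (k + n₀))) * Y + 2 * tailL2 c (k + n₀) := by
    intro k
    set n := k + n₀
    have hn : x ≤ 2 ^ n := by
      refine (lt_pow_level_succ hx1).le.trans ?_
      exact pow_le_pow_right₀ (by norm_num) (by omega)
    -- This `K` is large enough for 1 + log(K + 1) ≥ 2^n, so its tail starts at block `n`, yet small
    -- enough for the first term to decay.
    refine (hf _ ⌈Real.exp (2 ^ n - 1)⌉₊).trans (add_le_add ?_ ?_)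
    · rw [mul_right_comm]
      exact mul_le_mul' (head_coeff_le hM hn) h0Y
    · rw [ENNReal.mul_rpow_of_nonneg _ _ hpos]
      refine mul_le_mul' hsq2 (tailSq_rpow_le_tailL2 c ?_)
      have h1 : Real.exp (2 ^ n - 1) ≤ (⌈Real.exp (2 ^ n - 1)⌉₊ : ℕ) + 1 :=
        (Nat.le_ceil _).trans (by linarith)
      have h2 := (Real.le_log_iff_exp_le ((Real.exp_pos _).trans_le h1)).2 h1
      rw [seqWeight]
      linarith
  have hx2 : (2 : ℝ≥0∞) ^ ((n₀ + 2 : ℕ) * γ) ≤ 2 ^ (3 * γ) * ENNReal.ofReal (x ^ γ) := by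
    rw [show (((n₀ + 2 : ℕ) : ℝ) * γ) = 3 * γ + level x * γ by rw [hn₀]; push_cast; ring,
      two_rpow_add, ENNReal.rpow_mul _ (level x : ℝ), ← ENNReal.ofReal_rpow_of_pos (by linarith),
      ENNReal.rpow_natCast]
    gcongr
    calc (2 : ℝ≥0∞) ^ level x = ENNReal.ofReal (2 ^ level x) := by
          rw [ENNReal.ofReal_pow (by norm_num)]; simp
      _ ≤ _ := ENNReal.ofReal_le_ofReal (pow_level_le hx1)
  have hxγ : 1 ≤ ENNReal.ofReal (x ^ γ) := by
    rw [← ENNReal.ofReal_one]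
    exact ENNReal.ofReal_le_ofReal (Real.one_le_rpow hx1 hγ.le)
  have hhead : ∑ m ∈ Finset.range (n₀ + 2), (2 : ℝ≥0∞) ^ (m * γ) * partialL2 f (blockTime m) ≤
      2 * A * 2 ^ (3 * γ) * ENNReal.ofReal (x ^ γ) * Y := by
    calc _ ≤ ∑ m ∈ Finset.range (n₀ + 2), (2 : ℝ≥0∞) ^ (m * γ) * (2 * Y) :=
          Finset.sum_le_sum fun m _ => mul_le_mul' le_rfl (hcrude _)
      _ = (∑ m ∈ Finset.range (n₀ + 2), (2 : ℝ≥0∞) ^ (m * γ)) * (2 * Y) :=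
          (Finset.sum_mul _ _ _).symm
      _ ≤ (A * (2 ^ (3 * γ) * ENNReal.ofReal (x ^ γ))) * (2 * Y) := by
          gcongr
          exact (hA _).trans (mul_le_mul' le_rfl hx2)
      _ = _ := by ring
  have hB2 : eLpNorm (fun k : ℕ => 2 * (B * (2⁻¹ : ℝ≥0∞) ^ k) * Y) q Measure.count ≤
      2 * B * 2 * Y := by
    refine (eLpNorm_count_le_tsum _ hq).trans (le_of_eq ?_)
    rw [ENNReal.tsum_mul_right, ENNReal.tsum_mul_left, ENNReal.tsum_mul_left,
      ENNReal.tsum_geometric, ENNReal.one_sub_inv_two, inv_inv]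
    ring
  have htail : eLpNorm (fun k : ℕ => (2 : ℝ≥0∞) ^ ((k + (n₀ + 2) : ℕ) * γ) *
      partialL2 f (blockTime (k + (n₀ + 2)))) q Measure.count ≤
      2 ^ (2 * γ) * (2 * B * 2 + 2) * Y := by
    calc _ ≤ eLpNorm (fun k : ℕ => 2 ^ (2 * γ) * (2 * (B * (2⁻¹ : ℝ≥0∞) ^ k) * Y +
            2 * ((2 : ℝ≥0∞) ^ ((k + n₀ : ℕ) * γ) * tailL2 c (k + n₀)))) q Measure.count := by
          refine eLpNorm_mono_enorm fun k => ?_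
          simp only [enorm_eq_self]
          rw [show (((k + (n₀ + 2) : ℕ) : ℝ) * γ) = 2 * γ + (k + n₀ : ℕ) * γ by push_cast; ring,
            two_rpow_add, mul_assoc]
          gcongr
          calc _ ≤ (2 : ℝ≥0∞) ^ ((k + n₀ : ℕ) * γ) *
                (2 * ENNReal.ofReal (Real.exp (-(1 / 2) * 2 ^ (k + n₀))) * Y +
                  2 * tailL2 c (k + n₀)) := mul_le_mul' le_rfl (hfine k)
            _ = 2 * ((2 : ℝ≥0∞) ^ ((k + n₀ : ℕ) * γ) *
                ENNReal.ofReal (Real.exp (-(1 / 2) * 2 ^ (k + n₀)))) * Y +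
                2 * ((2 : ℝ≥0∞) ^ ((k + n₀ : ℕ) * γ) * tailL2 c (k + n₀)) := by ring
            _ ≤ _ := by
                refine add_le_add (mul_le_mul' (mul_le_mul' le_rfl ((hB _).trans ?_)) le_rfl) le_rfl
                exact mul_le_mul' le_rfl (pow_le_pow_right_of_le_one' (by norm_num) (by omega))
      _ = 2 ^ (2 * γ) * eLpNorm ((fun k : ℕ => 2 * (B * (2⁻¹ : ℝ≥0∞) ^ k) * Y) + fun k : ℕ =>
            2 * ((2 : ℝ≥0∞) ^ ((k + n₀ : ℕ) * γ) * tailL2 c (k + n₀))) q Measure.count :=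
          eLpNorm_const_mul _ (hfin _) hq0
      _ ≤ 2 ^ (2 * γ) * (2 * B * 2 * Y + 2 * Y) := by
          gcongr
          refine (eLpNorm_add_le measurable_from_top.aestronglyMeasurable
            measurable_from_top.aestronglyMeasurable hq).trans (add_le_add hB2 ?_)
          rw [eLpNorm_const_mul _ (by norm_num) hq0]
          gcongr
          exact eLpNorm_count_comp_le (fun n : ℕ => (2 : ℝ≥0∞) ^ (n * γ) * tailL2 c n) hq0
            (add_left_injective n₀)
      _ = _ := by ring
  refine (eLpNorm_count_le_sum_add _ hq (n₀ + 2)).trans ((add_le_add hhead htail).trans ?_)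
  calc _ ≤ 2 * A * 2 ^ (3 * γ) * ENNReal.ofReal (x ^ γ) * Y +
        2 ^ (2 * γ) * (2 * B * 2 + 2) * ENNReal.ofReal (x ^ γ) * Y := by
        refine add_le_add le_rfl (mul_le_mul' ?_ le_rfl)
        exact le_mul_of_one_le_right' hxγ
    _ = _ := by rw [hD]; ring

/-! ### Hardy's inequality for geometric weights. -/

theorem two_rpow_ne_top (a : ℝ) : (2 : ℝ≥0∞) ^ a ≠ ∞ :=
  ENNReal.rpow_ne_top_of_ne_zero (by norm_num) (by norm_num)

/-- Hardy's inequality with geometric weights. -/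
theorem exists_eLpNorm_tail_le {γ : ℝ} (hγ : 0 < γ) : ∃ C : ℝ≥0, ∀ (b : ℕ → ℝ≥0∞) (q : ℝ≥0∞),
    1 ≤ q → eLpNorm (fun n : ℕ => (2 : ℝ≥0∞) ^ (n * γ) * ∑' i, b (n + i)) q Measure.count ≤
      C * eLpNorm (fun n : ℕ => (2 : ℝ≥0∞) ^ (n * γ) * b n) q Measure.count := by
  set r : ℝ≥0∞ := 2 ^ (-γ) with hr
  have hr1 : r < 1 := ENNReal.rpow_lt_one_of_one_lt_of_neg (by norm_num) (neg_lt_zero.2 hγ)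
  have hrt : (1 - r)⁻¹ ≠ ∞ := ENNReal.inv_ne_top.2 (tsub_pos_of_lt hr1).ne'
  refine ⟨((1 - r)⁻¹).toNNReal, fun b q hq => ?_⟩
  rw [ENNReal.coe_toNNReal hrt]
  have hq0 : q ≠ 0 := (zero_lt_one.trans_le hq).ne'
  -- Moving the weight from `n` to `n + i` leaves a factor `r ^ i` with r = 2^{-γ} < 1; Minkowski
  -- and shift-monotonicity then give a geometric series.
  calc _ = eLpNorm (fun n : ℕ => ∑' i : ℕ, r ^ i * ((2 : ℝ≥0∞) ^ ((n + i : ℕ) * γ) * b (n + i))) q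
        Measure.count := by
        congr
        ext n
        rw [← ENNReal.tsum_mul_left]
        refine tsum_congr fun i => ?_
        rw [← mul_assoc, hr, ← ENNReal.rpow_mul_natCast, ← two_rpow_add]
        congr 2
        push_cast
        ring
    _ ≤ ∑' i : ℕ, eLpNorm (fun n : ℕ => r ^ i * ((2 : ℝ≥0∞) ^ ((n + i : ℕ) * γ) * b (n + i))) q
        Measure.count := eLpNorm_tsum_le (fun i => measurable_from_top) hq
    _ ≤ ∑' i : ℕ, r ^ i *
        eLpNorm (fun n : ℕ => (2 : ℝ≥0∞) ^ (n * γ) * b n) q Measure.count := by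
        refine ENNReal.tsum_le_tsum fun i => ?_
        rw [eLpNorm_const_mul _ (ENNReal.pow_ne_top hr1.ne_top) hq0]
        gcongr
        exact eLpNorm_count_comp_le (fun n : ℕ => (2 : ℝ≥0∞) ^ (n * γ) * b n) hq0
          (add_left_injective i)
    _ = _ := by rw [ENNReal.tsum_mul_right, ENNReal.tsum_geometric]

/-! ### Coefficient norms compared with block norms. -/

section SeqMeasure

/-- The measure `∑_k k⁻¹ δ_k` on the positive integers `k = j + 1`. -/
def harmonicMeasure : Measure ℕ :=
  Measure.count.withDensity fun j : ℕ => ((j : ℝ≥0∞) + 1)⁻¹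

theorem eLpNorm_harmonicMeasure_restrict (s : Set ℕ) (g : ℕ → ℝ≥0∞) {p : ℝ≥0∞} (hp0 : p ≠ 0) :
    eLpNorm g p (harmonicMeasure.restrict s) =
      eLpNorm (fun j : ℕ => ((j : ℝ≥0∞) + 1)⁻¹ ^ recip p * g j) p (Measure.count.restrict s) := by
  rw [harmonicMeasure, restrict_withDensity MeasurableSpace.measurableSet_top,
    eLpNorm_rpow_recip_mul measurable_from_top _ _ hp0]
  · exact Filter.Eventually.of_forall fun j => by simp
  · exact Filter.Eventually.of_forall fun j => by simp

variable {ι : Type} (c : ι → ℂ)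

/-- The sequence `k^{1/2} c_k^*`. -/
def scaledRearr (j : ℕ) : ℝ≥0∞ := ((j : ℝ≥0∞) + 1) ^ (1 / 2 : ℝ) * seqRearr c j

theorem lzSeqNorm_two_eq {q : ℝ≥0∞} (hq0 : q ≠ 0) (β : ℝ) :
    lzSeqNorm 2 q β c =
      eLpNorm (fun j => ENNReal.ofReal (seqWeight j) ^ β * scaledRearr c j) q harmonicMeasure := by
  rw [← Measure.restrict_univ (μ := harmonicMeasure), eLpNorm_harmonicMeasure_restrict _ _ hq0,
    Measure.restrict_univ]
  refine congrArg (fun f => eLpNorm f q Measure.count) (funext fun j => ?_)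
  have h1 : (0 : ℝ) < (j : ℝ) + 1 := by positivity
  have h2 : ENNReal.ofReal ((j : ℝ) + 1) = (j : ℝ≥0∞) + 1 := by
    rw [ENNReal.ofReal_add (by positivity) (by norm_num)]; simp
  rw [ENNReal.ofReal_mul (Real.rpow_nonneg h1.le _), ← ENNReal.ofReal_rpow_of_pos h1, ← seqWeight,
    ← ENNReal.ofReal_rpow_of_pos (zero_lt_one.trans_le (one_le_seqWeight j)), h2, recip_two,
    sub_eq_add_neg, ENNReal.rpow_add _ _ (by simp) (by simp), ENNReal.inv_rpow,
    ENNReal.rpow_neg, scaledRearr]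
  ring

theorem blockL2_eq (n : ℕ) :
    blockL2 c n = eLpNorm (scaledRearr c) 2 (harmonicMeasure.restrict (block seqWeight n)) := by
  rw [eLpNorm_harmonicMeasure_restrict _ _ (by norm_num), blockL2]
  refine congrArg (fun f => eLpNorm f 2 _) (funext fun j => ?_)
  rw [scaledRearr, recip_two, ← mul_assoc, ENNReal.inv_rpow, ENNReal.inv_mul_cancel, one_mul]
  · simp
  · exact ENNReal.rpow_ne_top_of_nonneg (by norm_num) (by simp)

theorem harmonicMeasure_finset (F : Finset ℕ) :
    harmonicMeasure F = ∑ j ∈ F, ((j : ℝ≥0∞) + 1)⁻¹ := by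
  rw [harmonicMeasure, withDensity_apply _ MeasurableSpace.measurableSet_top,
    ← lintegral_indicator MeasurableSpace.measurableSet_top, lintegral_count,
    tsum_eq_sum (s := F) fun j hj => indicator_of_notMem (by simpa using hj) _]
  exact Finset.sum_congr rfl fun j hj => indicator_of_mem (by simpa using hj) _

/-- The block lies among the k ≤ exp(2^{m+1} - 1), and the harmonic sum up to N is at most 1 + log
N. -/
theorem harmonicMeasure_block_le (m : ℕ) :
    harmonicMeasure (block seqWeight m) ≤ 2 ^ ((m : ℝ) + 1) := by
  set N : ℕ := ⌊Real.exp (2 ^ (m + 1) - 1)⌋₊ with hN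
  have hN1 : N ≠ 0 := by
    refine (Nat.floor_pos.2 (Real.one_le_exp ?_)).ne'
    have : (1 : ℝ) ≤ 2 ^ (m + 1) := one_le_pow₀ (by norm_num)
    linarith
  have hsub : block seqWeight m ⊆ (Finset.range N : Set ℕ) := by
    intro j hj
    have hj' : level (seqWeight j) = m := hj
    have h1 := lt_pow_level_succ (one_le_seqWeight j)
    rw [hj', seqWeight] at h1
    have h2 : Real.log ((j : ℝ) + 1) ≤ 2 ^ (m + 1) - 1 := by linarith
    rw [Real.log_le_iff_le_exp (by positivity)] at h2
    have h3 : j + 1 ≤ N := Nat.le_floor (by exact_mod_cast h2)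
    simpa using h3
  refine (measure_mono hsub).trans ?_
  rw [harmonicMeasure_finset]
  have e : ∑ j ∈ Finset.range N, ((j : ℝ≥0∞) + 1)⁻¹ = ENNReal.ofReal ((harmonic N : ℚ) : ℝ) := by
    rw [harmonic]
    push_cast
    rw [ENNReal.ofReal_sum_of_nonneg fun j _ => by positivity]
    refine Finset.sum_congr rfl fun j _ => ?_
    rw [ENNReal.ofReal_inv_of_pos (by positivity), ENNReal.ofReal_add (by positivity) (by norm_num)]
    simp
  have e2 : (2 : ℝ≥0∞) ^ ((m : ℝ) + 1) = ENNReal.ofReal (2 ^ (m + 1)) := by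
    rw [ENNReal.ofReal_pow (by norm_num), ← ENNReal.rpow_natCast]
    simp
  rw [e, e2]
  refine ENNReal.ofReal_le_ofReal ((harmonic_le_one_add_log N).trans ?_)
  have h4 : Real.log N ≤ 2 ^ (m + 1) - 1 := by
    rw [Real.log_le_iff_le_exp (by exact_mod_cast Nat.pos_of_ne_zero hN1)]
    exact Nat.floor_le (Real.exp_pos _).le
  linarith

/-- Hölder from L_q to L_2 on a block costs 2^{(n+1)(1/2 - 1/q)}, which turns α + 1/q into α + 1/2.
-/
theorem exists_blockL2_le_of_two_le {q : ℝ≥0∞} (hq : 2 ≤ q) (α : ℝ) : ∃ C : ℝ≥0,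
    ∀ {ι : Type} (c : ι → ℂ),
      eLpNorm (fun n : ℕ => (2 : ℝ≥0∞) ^ (n * (α + recip q)) * blockL2 c n) q Measure.count ≤
        C * lzSeqNorm 2 q (α + 1 / 2) c := by
  have hq0 : q ≠ 0 := (lt_of_lt_of_le (by norm_num) hq).ne'
  have hr0 : 0 ≤ 1 / 2 - recip q := by
    rw [← recip_two]
    exact sub_nonneg.2 (ENNReal.toReal_mono (by simp) (ENNReal.inv_le_inv.2 hq))
  have hDt : (2 : ℝ≥0∞) ^ (1 / 2 - recip q) * 2 ^ |α + 1 / 2| ≠ ∞ :=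
    ENNReal.mul_ne_top (two_rpow_ne_top _) (two_rpow_ne_top _)
  refine ⟨((2 : ℝ≥0∞) ^ (1 / 2 - recip q) * 2 ^ |α + 1 / 2|).toNNReal, fun c => ?_⟩
  rw [ENNReal.coe_toNNReal hDt, lzSeqNorm_two_eq c hq0, mul_assoc]
  refine le_trans ?_ (mul_le_mul' le_rfl (eLpNorm_block_le_weight harmonicMeasure
    measurable_from_top one_le_seqWeight (scaledRearr c) hq0 (α + 1 / 2)))
  rw [← eLpNorm_const_mul _ (two_rpow_ne_top _) hq0]
  refine eLpNorm_mono_enorm fun n => ?_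
  simp only [enorm_eq_self]
  have h := eLpNorm_le_eLpNorm_mul_rpow_measure_univ hq (f := scaledRearr c)
    (μ := harmonicMeasure.restrict (block seqWeight n)) measurable_from_top.aestronglyMeasurable
  have hr : (1 / (2 : ℝ≥0∞).toReal - 1 / q.toReal) = 1 / 2 - recip q := by
    simp [recip, ENNReal.toReal_inv]
  rw [hr, ← blockL2_eq, Measure.restrict_apply_univ] at h
  calc _ ≤ (2 : ℝ≥0∞) ^ (n * (α + recip q)) *
        (eLpNorm (scaledRearr c) q (harmonicMeasure.restrict (block seqWeight n)) *
          (2 ^ ((n : ℝ) + 1)) ^ (1 / 2 - recip q)) := by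
        refine mul_le_mul' le_rfl (h.trans (mul_le_mul' le_rfl ?_))
        exact ENNReal.rpow_le_rpow (harmonicMeasure_block_le n) hr0
    _ = 2 ^ (n * (α + recip q) + (n + 1) * (1 / 2 - recip q)) *
        eLpNorm (scaledRearr c) q (harmonicMeasure.restrict (block seqWeight n)) := by
        rw [two_rpow_add (n * (α + recip q)), ENNReal.rpow_mul _ ((n : ℝ) + 1)]; ring
    _ = _ := by
        rw [← mul_assoc, ← two_rpow_add]
        ring_nf

/-- Halving the index lowers the weight by at most log 2 < 1 ≤ 2^{n-1}, so from a weight of at least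
2^n the level drops by at most one. For `n = 0`, truncated subtraction makes both blocks the same.
-/
theorem block_subset_of_half_le {n i j : ℕ} (hj : level (seqWeight j) = n) (hij : i ≤ j)
    (hi : j / 2 ≤ i) : i ∈ block seqWeight n ∪ block seqWeight (n - 1) := by
  have hle : seqWeight i ≤ seqWeight j := by
    unfold seqWeight
    gcongr
  have h1 : level (seqWeight i) ≤ n := by
    by_contra! hlt
    have := (le_level_iff (one_le_seqWeight i) (n + 1)).1 hlt
    have h2 := lt_pow_level_succ (one_le_seqWeight j)
    rw [hj] at h2
    linarith
  have h2 : n - 1 ≤ level (seqWeight i) := by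
    rcases Nat.eq_zero_or_pos n with rfl | hn
    · simp
    rw [le_level_iff (one_le_seqWeight i)]
    have h3 := pow_level_le (one_le_seqWeight j)
    rw [hj] at h3
    have h4 : (2 : ℝ) ^ n = 2 * 2 ^ (n - 1) := by
      rw [← pow_succ']
      congr 1
      omega
    have h5 : (1 : ℝ) ≤ 2 ^ (n - 1) := one_le_pow₀ (by norm_num)
    have h6 : seqWeight j ≤ seqWeight i + Real.log 2 := by
      unfold seqWeight
      have : Real.log ((j : ℝ) + 1) ≤ Real.log (2 * ((i : ℝ) + 1)) := by
        refine Real.log_le_log (by positivity) ?_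
        have : j + 1 ≤ 2 * (i + 1) := by omega
        exact_mod_cast this
      rw [Real.log_mul (by norm_num) (by positivity)] at this
      linarith
    have h7 := Real.log_two_lt_d9
    linarith
  have : level (seqWeight i) = n ∨ level (seqWeight i) = n - 1 := by omega
  exact this

/-- By monotonicity of c*, the value at `j` is at most twice the value at any `i` between `j / 2`
and `j`, and this range has harmonic measure at least 1/2. The two losses multiply to 4. -/
theorem scaledRearr_le {q : ℝ≥0∞} (hq1 : 1 ≤ q) (hqt : q ≠ ∞) (j : ℕ) :
    scaledRearr c j ≤ 4 * eLpNorm (scaledRearr c) q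
      (harmonicMeasure.restrict (Finset.Icc (j / 2) j : Finset ℕ)) := by
  have hq0 : q ≠ 0 := (zero_lt_one.trans_le hq1).ne'
  have hq' : 1 ≤ q.toReal := by simpa using ENNReal.toReal_mono hqt hq1
  set I : Finset ℕ := Finset.Icc (j / 2) j with hI
  have hmeas : (2⁻¹ : ℝ≥0∞) ≤ harmonicMeasure I := by
    rw [harmonicMeasure_finset]
    calc (2⁻¹ : ℝ≥0∞) ≤ I.card • ((j : ℝ≥0∞) + 1)⁻¹ := by
          rw [nsmul_eq_mul, ← div_eq_mul_inv, ENNReal.le_div_iff_mul_le (by simp) (by simp),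
            mul_comm, ← div_eq_mul_inv, ENNReal.div_le_iff_le_mul (by simp) (by simp), hI,
            Nat.card_Icc]
          have : j + 1 ≤ (j + 1 - j / 2) * 2 := by omega
          exact_mod_cast this
      _ ≤ _ := by
          refine Finset.card_nsmul_le_sum _ _ _ fun i hi => ?_
          rw [hI, Finset.mem_Icc] at hi
          exact ENNReal.inv_le_inv.2 (by exact_mod_cast Nat.succ_le_succ hi.2)
  have hpt : ∀ i ∈ I, 2⁻¹ * scaledRearr c j ≤ scaledRearr c i := by
    intro i hi
    rw [hI, Finset.mem_Icc] at hi
    rw [scaledRearr, scaledRearr, ← mul_assoc]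
    refine mul_le_mul' ?_ (seqRearr_antitone c hi.2)
    have h1 : (j : ℝ≥0∞) + 1 ≤ 4 * ((i : ℝ≥0∞) + 1) := by
      have : j + 1 ≤ 4 * (i + 1) := by omega
      exact_mod_cast this
    have h2 := ENNReal.rpow_le_rpow h1 (show (0 : ℝ) ≤ 1 / 2 by norm_num)
    rw [ENNReal.mul_rpow_of_nonneg _ _ (by norm_num),
      show (4 : ℝ≥0∞) = 2 ^ (2 : ℝ) by norm_num, ← ENNReal.rpow_mul] at h2
    norm_num at h2
    calc _ ≤ 2⁻¹ * (2 * ((i : ℝ≥0∞) + 1) ^ (1 / 2 : ℝ)) := by gcongr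
      _ = _ := by
          rw [← mul_assoc, ENNReal.inv_mul_cancel (by norm_num) (by norm_num), one_mul]
  have hlow : 2⁻¹ * scaledRearr c j * 2⁻¹ ≤
      eLpNorm (scaledRearr c) q (harmonicMeasure.restrict I) := by
    calc _ ≤ eLpNorm (fun _ => 2⁻¹ * scaledRearr c j) q (harmonicMeasure.restrict I) := by
          rw [eLpNorm_eq_lintegral_rpow_enorm_toReal hq0 hqt]
          simp only [enorm_eq_self, lintegral_const, Measure.restrict_apply_univ]
          rw [ENNReal.mul_rpow_of_nonneg _ _ (by positivity), ← ENNReal.rpow_mul,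
            mul_one_div_cancel (by positivity), ENNReal.rpow_one]
          gcongr
          calc (2⁻¹ : ℝ≥0∞) ≤ 2⁻¹ ^ (1 / q.toReal) := by
                have := ENNReal.rpow_le_rpow_of_exponent_ge (x := 2⁻¹) (by norm_num)
                  (show 1 / q.toReal ≤ 1 from (div_le_one (by positivity)).2 hq')
                simpa using this
            _ ≤ _ := ENNReal.rpow_le_rpow hmeas (by positivity)
      _ ≤ _ := by
          refine eLpNorm_mono_enorm_ae ?_
          filter_upwards [ae_restrict_mem MeasurableSpace.measurableSet_top] with i hi
          exact hpt i hi
  calc scaledRearr c j = 4 * (2⁻¹ * scaledRearr c j * 2⁻¹) := by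
        rw [mul_right_comm, ← mul_assoc, ← ENNReal.mul_inv (by simp) (by simp),
          show (2 : ℝ≥0∞) * 2 = 4 by norm_num, ENNReal.mul_inv_cancel (by norm_num) (by norm_num),
          one_mul]
    _ ≤ _ := by gcongr

theorem eLpNorm_restrict_union_le {X : Type*} [MeasurableSpace X] {μ : Measure X} {f : X → ℝ≥0∞}
    (hf : Measurable f) {s t : Set X} (hs : MeasurableSet s) (ht : MeasurableSet t) {p : ℝ≥0∞}
    (hp : 1 ≤ p) :
    eLpNorm f p (μ.restrict (s ∪ t)) ≤ eLpNorm f p (μ.restrict s) + eLpNorm f p (μ.restrict t) := by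
  simp only [← eLpNorm_indicator_eq_eLpNorm_restrict hs,
    ← eLpNorm_indicator_eq_eLpNorm_restrict ht,
    ← eLpNorm_indicator_eq_eLpNorm_restrict (hs.union ht)]
  refine le_trans (eLpNorm_mono_enorm fun x => ?_) (eLpNorm_add_le
    (hf.indicator hs).aestronglyMeasurable (hf.indicator ht).aestronglyMeasurable hp)
  simp only [enorm_eq_self, Pi.add_apply]
  by_cases h1 : x ∈ s <;> by_cases h2 : x ∈ t <;> simp [h1, h2]

/-- For q ≤ 2 Hölder goes the wrong way. Instead `scaledRearr_le` bounds the sequence pointwise by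
its local L_q-norm, and a function bounded by the same number pointwise and in L_q is bounded by it
in L_2. The preceding block enters because the range down to `j / 2` may cross into it. -/
theorem blockL2_le_of_le_two {q : ℝ≥0∞} (hq1 : 1 ≤ q) (hq : q ≤ 2) (n : ℕ) :
    blockL2 c n ≤
      4 * (eLpNorm (scaledRearr c) q (harmonicMeasure.restrict (block seqWeight n)) +
        eLpNorm (scaledRearr c) q (harmonicMeasure.restrict (block seqWeight (n - 1)))) := by
  have hq0 : q ≠ 0 := (zero_lt_one.trans_le hq1).ne'
  have hqt : q ≠ ∞ := ne_top_of_le_ne_top (by norm_num) hq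
  rw [blockL2_eq]
  refine eLpNorm_le_of_exponent_le_of_bound hq0 hq ?_ ?_
  · filter_upwards [ae_restrict_mem MeasurableSpace.measurableSet_top] with j hj
    refine (scaledRearr_le c hq1 hqt j).trans ?_
    gcongr
    refine le_trans (eLpNorm_mono_measure _ (Measure.restrict_mono ?_ le_rfl))
      (eLpNorm_restrict_union_le measurable_from_top MeasurableSpace.measurableSet_top
        MeasurableSpace.measurableSet_top hq1)
    intro i hi
    have hi' : j / 2 ≤ i ∧ i ≤ j := by simpa using hi
    exact block_subset_of_half_le hj hi'.2 hi'.1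
  · refine le_self_add.trans (le_mul_of_one_le_left' (by norm_num))

theorem exists_blockL2_le_of_le_two {q : ℝ≥0∞} (hq1 : 1 ≤ q) (hq : q ≤ 2) (γ : ℝ) : ∃ C : ℝ≥0,
    ∀ {ι : Type} (c : ι → ℂ),
      eLpNorm (fun n : ℕ => (2 : ℝ≥0∞) ^ (n * γ) * blockL2 c n) q Measure.count ≤
        C * lzSeqNorm 2 q γ c := by
  have hq0 : q ≠ 0 := (zero_lt_one.trans_le hq1).ne'
  set D : ℝ≥0∞ := 4 * (2 + 2 ^ γ) * 2 ^ |γ| with hD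
  have hDt : D ≠ ∞ := by
    have h1 := two_rpow_ne_top γ
    have h2 := two_rpow_ne_top |γ|
    rw [hD]
    finiteness
  refine ⟨D.toNNReal, fun c => ?_⟩
  rw [ENNReal.coe_toNNReal hDt, lzSeqNorm_two_eq c hq0, hD, mul_assoc]
  refine le_trans ?_ (mul_le_mul' le_rfl (eLpNorm_block_le_weight harmonicMeasure
    measurable_from_top one_le_seqWeight (scaledRearr c) hq0 γ))
  set a : ℕ → ℝ≥0∞ :=
    fun n => eLpNorm (scaledRearr c) q (harmonicMeasure.restrict (block seqWeight n)) with ha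
  set Z := eLpNorm (fun n : ℕ => (2 : ℝ≥0∞) ^ (n * γ) * a n) q Measure.count with hZ
  have hshift : eLpNorm (fun n : ℕ => (2 : ℝ≥0∞) ^ (n * γ) * a (n - 1)) q Measure.count ≤
      Z + 2 ^ γ * Z := by
    refine (eLpNorm_count_le_add_succ _ hq1).trans (add_le_add ?_ ?_)
    -- At `n = 0` the truncated index `n - 1` is again 0, so this term is already a term of `Z`.
    · simpa using le_eLpNorm_count (fun n : ℕ => (2 : ℝ≥0∞) ^ (n * γ) * a n) hq0 0
    · rw [hZ, ← eLpNorm_const_mul _ (two_rpow_ne_top _) hq0]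
      refine eLpNorm_mono_enorm fun n => ?_
      simp only [enorm_eq_self, add_tsub_cancel_right]
      rw [← mul_assoc, ← two_rpow_add]
      refine le_of_eq ?_
      push_cast
      ring_nf
  calc _ ≤ eLpNorm (fun n : ℕ => 4 * ((2 : ℝ≥0∞) ^ (n * γ) * a n +
        (2 : ℝ≥0∞) ^ (n * γ) * a (n - 1))) q Measure.count := by
        refine eLpNorm_mono_enorm fun n => ?_
        simp only [enorm_eq_self]
        calc _ ≤ (2 : ℝ≥0∞) ^ (n * γ) * (4 * (a n + a (n - 1))) :=
              mul_le_mul' le_rfl (blockL2_le_of_le_two c hq1 hq n)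
          _ = _ := by ring
    _ = 4 * eLpNorm ((fun n : ℕ => (2 : ℝ≥0∞) ^ (n * γ) * a n) +
        fun n : ℕ => (2 : ℝ≥0∞) ^ (n * γ) * a (n - 1)) q Measure.count :=
        eLpNorm_const_mul _ (by norm_num) hq0
    _ ≤ 4 * (Z + (Z + 2 ^ γ * Z)) := by
        gcongr
        exact (eLpNorm_add_le measurable_from_top.aestronglyMeasurable
          measurable_from_top.aestronglyMeasurable hq1).trans (add_le_add le_rfl hshift)
    _ = _ := by ring

end SeqMeasure

/-! ### Assembly of the estimates. -/

theorem exists_tailL2_le {q : ℝ≥0∞} (hq : 1 ≤ q) {α : ℝ} (hα : 0 < α + recip q) : ∃ C : ℝ≥0,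
    ∀ {ι : Type} (c : ι → ℂ),
      eLpNorm (fun n : ℕ => (2 : ℝ≥0∞) ^ (n * (α + recip q)) * tailL2 c n) q Measure.count ≤
        C * lzSeqNorm 2 q (α + recip (min q 2)) c := by
  obtain ⟨A, hA⟩ := exists_eLpNorm_tail_le hα
  have hB : ∃ B : ℝ≥0, ∀ {ι : Type} (c : ι → ℂ),
      eLpNorm (fun n : ℕ => (2 : ℝ≥0∞) ^ (n * (α + recip q)) * blockL2 c n) q Measure.count ≤
        B * lzSeqNorm 2 q (α + recip (min q 2)) c := by
    rcases le_total q 2 with h | h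
    · rw [min_eq_left h]
      exact exists_blockL2_le_of_le_two hq h _
    · rw [min_eq_right h, recip_two]
      exact exists_blockL2_le_of_two_le h α
  obtain ⟨B, hB⟩ := hB
  refine ⟨A * B, fun c => (hA (blockL2 c) q hq).trans ?_⟩
  rw [ENNReal.coe_mul, mul_assoc]
  gcongr
  exact hB c

theorem lzNorm_le_blockNorm {q : ℝ≥0∞} (hq0 : q ≠ 0) (α : ℝ) : ∃ C : ℝ≥0, ∀ f : ℝ → ℂ,
    max (lzNorm 2 q (α + recip (max q 2)) f) (lzNorm 2 (max q 2) (α + recip q) f) ≤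
      C * blockNorm q (α + recip q) f := by
  have h2 : ∀ f, lzNorm 2 (max q 2) (α + recip q) f ≤
      2 ^ |α + recip q| * blockNorm q (α + recip q) f := fun f =>
    lzNorm_le_blockNorm_of_two_le hq0 (le_max_right _ _) (le_max_left _ _) _ f
  have h1 : ∃ β : ℝ, ∀ f, lzNorm 2 q (α + recip (max q 2)) f ≤
      2 ^ |β| * blockNorm q (α + recip q) f := by
    rcases le_total q 2 with h | h
    · rw [max_eq_right h, recip_two]
      exact ⟨_, lzNorm_le_blockNorm_of_le_two hq0 h α⟩
    · rw [max_eq_left h]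
      exact ⟨_, lzNorm_le_blockNorm_of_two_le hq0 h le_rfl _⟩
  obtain ⟨β, h1⟩ := h1
  refine ⟨((2 : ℝ≥0∞) ^ |β| + 2 ^ |α + recip q|).toNNReal, fun f => ?_⟩
  rw [ENNReal.coe_toNNReal (ENNReal.add_ne_top.2 ⟨two_rpow_ne_top _, two_rpow_ne_top _⟩)]
  exact max_le ((h1 f).trans (mul_le_mul' le_self_add le_rfl))
    ((h2 f).trans (mul_le_mul' le_add_self le_rfl))

/-- On a probability space the L_2-norm, here 1, is at most the L_∞-norm. Hence log M ≥ 0. -/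
theorem one_le_of_orthonormal {ι : Type} [Nonempty ι] {φ : ι → Lp ℂ 2 μ01} {M : ℝ≥0}
    (hφ : Orthonormal ℂ φ) (hM : (⨆ n, eLpNorm (φ n) ∞ μ01) = (M : ℝ≥0∞)) : 1 ≤ M := by
  obtain ⟨n⟩ := ‹Nonempty ι›
  have : IsProbabilityMeasure μ01 := ⟨by simp [μ01]⟩
  have h1 : ‖φ n‖ₑ = 1 := by
    rw [← ofReal_norm, hφ.1 n, ENNReal.ofReal_one]
  rw [← ENNReal.coe_le_coe, ENNReal.coe_one, ← h1, Lp.enorm_def, ← hM]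
  exact (eLpNorm_le_eLpNorm_of_exponent_le le_top (Lp.aestronglyMeasurable _)).trans
    (le_iSup (fun n => eLpNorm (φ n) ∞ μ01) n)

end LorentzZygmund

end

open LorentzZygmund in
theorem corollary4p4 (q : ℝ≥0∞) (hq : 1 < q) (α : ℝ)
    (hα_lower : max (-recip q) (recip q - 1) < α) (hα_upper : α < 1 - recip q) :
    ∃ ε₀ : ℝ, 0 < ε₀ ∧ ∀ ε : ℝ, 0 < ε → ε < ε₀ →
      ∃ C : ℝ≥0, ∀ (ι : Type) [Countable ι] [Infinite ι] (φ : ι → Lp ℂ 2 μ01) (M : ℝ≥0),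
        Orthonormal ℂ φ →
        (⨆ n, eLpNorm (φ n) ∞ μ01) = (M : ℝ≥0∞) →
        ∀ c : ι → ℂ, lzSeqNorm 2 q (α + recip (min q 2)) c < ∞ →
          ∃ f : Lp ℂ 2 μ01,
            HasSum (fun n => c n • φ n) f ∧
            limNorm 2 q α 2 f ≤
              C * ENNReal.ofReal ((1 + Real.log M) ^ |α + ε + recip q|) *
                lzSeqNorm 2 q (α + recip (min q 2)) c ∧
            max (lzNorm 2 q (α + recip (max q 2)) f) (lzNorm 2 (max q 2) (α + recip q) f) ≤
              C * ENNReal.ofReal ((1 + Real.log M) ^ |α + ε + recip q|) *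
                lzSeqNorm 2 q (α + recip (min q 2)) c := by
  -- Any positive threshold works: the argument gives the exponent α + 1/q, and 1 + log M ≥ 1 allows
  -- it to be raised to |α + ε + 1/q|.
  refine ⟨1, one_pos, fun ε hε _ => ?_⟩
  have hγ : 0 < α + recip q := by linarith [(max_lt_iff.1 hα_lower).1]
  have hq0 : q ≠ 0 := (zero_lt_one.trans hq).ne'
  obtain ⟨A, hA⟩ := exists_blockNorm_le hγ
  obtain ⟨B, hB⟩ := exists_tailL2_le hq.le hγ
  obtain ⟨D, hD⟩ := lzNorm_le_blockNorm hq0 α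
  have hlt : ((2 : ℝ≥0∞) ^ |α|) ≠ ∞ := two_rpow_ne_top _
  refine ⟨(((2 : ℝ≥0∞) ^ |α|).toNNReal + D) * (A * B), fun ι _ _ φ M hφ hM c hc => ?_⟩
  have hM1 := one_le_of_orthonormal hφ hM
  set N := lzSeqNorm 2 q (α + recip (min q 2)) c with hN
  -- The `n = 0` term of the weighted tail sequence already dominates the l_2-norm of c*, so
  -- square-summability follows from the finite Lorentz–Zygmund norm.
  have hfin : tailSq c 0 ≠ ∞ := by
    have h1 := tailSq_rpow_le_tailL2 c (K := 0) (n := 0) (by simpa using one_le_seqWeight 0)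
    have h2 := le_eLpNorm_count
      (fun n : ℕ => (2 : ℝ≥0∞) ^ (n * (α + recip q)) * tailL2 c n) hq0 0
    have h3 : tailSq c 0 ^ (1 / 2 : ℝ) ≤ B * N :=
      h1.trans (le_trans (by simpa using h2) (hB c))
    intro h
    rw [h, ENNReal.top_rpow_of_pos (by norm_num), top_le_iff] at h3
    exact ENNReal.mul_ne_top ENNReal.coe_ne_top hc.ne h3
  obtain ⟨f, hf, hest⟩ := exists_hasSum_partialL2_le hφ hM c hfin
  have hx1 : 1 ≤ 1 + Real.log M := by
    linarith [Real.log_nonneg (show (1 : ℝ) ≤ M by exact_mod_cast hM1)]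
  set W := ENNReal.ofReal ((1 + Real.log M) ^ |α + ε + recip q|) with hW
  have hWle : ENNReal.ofReal ((1 + Real.log M) ^ (α + recip q)) ≤ W := by
    refine ENNReal.ofReal_le_ofReal (Real.rpow_le_rpow_of_exponent_le hx1 ?_)
    exact le_trans (by linarith) (le_abs_self _)
  have hblock : blockNorm q (α + recip q) f ≤ (A * B : ℝ≥0) * W * N := by
    refine (hA c f M q hM1 hq.le hest).trans ?_
    calc _ ≤ A * W * (B * N) := mul_le_mul' (mul_le_mul' le_rfl hWle) (hB c)
      _ = _ := by rw [ENNReal.coe_mul]; ring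
  rw [ENNReal.coe_mul, ENNReal.coe_add, ENNReal.coe_toNNReal hlt, mul_assoc _ _ W, mul_assoc _ _ N]
  refine ⟨f, hf, (limNorm_le_blockNorm hq0 α f).trans (mul_le_mul' le_self_add hblock),
    (hD f).trans (mul_le_mul' le_add_self hblock)⟩
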